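/- Let $e_0,\dots,e_4$ be the standard basis of $\mathbb C^5$, $\mathbb P_4=\mathbb P(\mathbb C^5)$ the space of lines in $\mathbb C^5$, $Q=T_{\mathbb P_4}(-1)=(\mathbb C^5\otimes\mathcal O)/\mathcal O(-1)$, and $\pi:\mathbb C^5\otimes\mathcal O\to Q$ the projection. Define linear maps $a_\pm:\mathbb C^5\to\Lambda^2\mathbb C^5$ by $a_+(e_i)=e_{i+2}\wedge e_{i+3}$ and $a_-(e_i)=e_{i+1}\wedge e_{i+4}$ (indices modulo $5$), and consider the monad $$0\to\mathbb C^5\otimes\mathcal O\xrightarrow{\ a\ }(\Lambda^2Q)^{\oplus2}\xrightarrow{\ b\ }(\mathbb C^5)^*\otimes\Lambda^4Q=\mathrm{Hom}(\mathbb C^5\otimes\mathcal O,\Lambda^4Q)\to0,$$ $$a(x)(v)=\bigl(\Lambda^2\pi(x)(a_+v),\,\Lambda^2\pi(x)(a_-v)\bigr),\qquad b(x)(\xi,\eta)(v)=-\eta\wedge\Lambda^2\pi(x)(a_+v)+\xi\wedge\Lambda^2\pi(x)(a_-v).$$ Its cohomology $\ker b/\mathrm{im}\,a$ is $E(-2)$,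 where $E=(\ker b/\mathrm{im}\,a)\otimes\mathcal O(2)$ is the Horrocks–Mumford bundle, a holomorphic vector bundle of rank $2$ on $\mathbb P_4$. Let $h_1$ be the natural Hermitian metric on $E$ induced by the standard Hermitian inner product of $\mathbb C^5$: $Q$ carries the quotient metric, $\Lambda^2Q$ the induced metric (Gram determinants on decomposable elements), $(\Lambda^2Q)^{\oplus2}$ the orthogonal sum metric, $\ker b$ the restricted metric, $\ker b/\mathrm{im}\,a$ the quotient metric, $\mathcal O(-1)\subset\mathbb C^5\otimes\mathcal O$ the restricted metric, $\mathcal O(1)=\mathcal O(-1)^*$ the dual metric, and $E=(\ker b/\mathrm{im}\,a)\otimes\mathcal O(1)^{\otimes2}$ the tensor product metric. Let $g$ be the Fubini–Study metric on $\mathbb P_4$, with coefficients $g_{\alpha\beta}=\delta_{\alpha\beta}/n-\bar z_\alpha z_\beta/n^2$, $n=1+\sum_k|z_k|^2$, in each standard affine chart. For a Hermitian metric with matrix $H_{kl}=h(s_k,s_l)$ in a local holomorphic frame $(s_k)$, the Chern curvature is $F=\sum F_{\alpha\beta}\,dz_\alpha\wedge d\bar z_\beta$ with $$F_{\alpha\beta}=-\frac{\partial^2H}{\partial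 z_\alpha\partial\bar z_\beta}H^{-1}+\frac{\partial H}{\partial z_\alpha}H^{-1}\frac{\partial H}{\partial\bar z_\beta}H^{-1},$$ and the mean curvature is $K=\sum_{\alpha,\beta}g^{\beta\alpha}F_{\alpha\beta}$, where $(g^{\alpha\beta})=(g_{\alpha\beta})^{-1}$. The metric is $g$-Hermitian–Einstein if $K=\lambda\cdot\mathrm{id}$ on all of $\mathbb P_4$ for some real constant $\lambda$. **Theorem.** The natural metric $h_1$ on the Horrocks–Mumford bundle $E$ is not $g$-Hermitian–Einstein. -/

import Mathlib

noncomputable section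

namespace HorrocksMumford

open scoped LinearAlgebra.Projectivization TensorProduct ComplexConjugate

/-! ## Hermitian inner products on exterior powers -/

section ExteriorPower

variable {V : Type*} [NormedAddCommGroup V] [InnerProductSpace ℂ V] {n : ℕ}

/-- For fixed `η ∈ ⋀ⁿ V`, the alternating map whose value at `x`, for `η = y₁ ∧ ⋯ ∧ yₙ`,
is `conj (det ⟪xⱼ, yᵢ⟫)`. -/
def extAlt (η : ⋀[ℂ]^n V) : V [⋀^Fin n]→ₗ[ℂ] ℂ where
  toFun x := conj (exteriorPower.alternatingMapToDual ℂ V n (fun i => innerₛₗ ℂ (x i)) η)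
  map_update_add' := by
    intro _ m i x y
    have key : ∀ z : V, (fun j => innerₛₗ ℂ (Function.update m i z j)) =
        Function.update (fun j => innerₛₗ ℂ (m j)) i (innerₛₗ ℂ z) := by
      intro z
      funext j
      by_cases h : j = i
      · subst h; simp
      · simp [h]
    rw [key, key, key, map_add, AlternatingMap.map_update_add, LinearMap.add_apply, map_add]
  map_update_smul' := by
    intro _ m i c x
    have key : ∀ z : V, (fun j => innerₛₗ ℂ (Function.update m i z j)) =
        Function.update (fun j => innerₛₗ ℂ (m j)) i (innerₛₗ ℂ z) := by
      intro z
      funext j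
      by_cases h : j = i
      · subst h; simp
      · simp [h]
    rw [key, key, LinearMap.map_smulₛₗ, AlternatingMap.map_update_smul, LinearMap.smul_apply]
    simp
  map_eq_zero_of_eq' := by
    intro v i j h hij
    rw [AlternatingMap.map_eq_zero_of_eq _ _ (by simp [h]) hij]
    simp

/-- The Hermitian form on `⋀ⁿ V` (conjugate linear in the first argument), given on
decomposable elements by the Gram determinant. -/
def extInner (ξ η : ⋀[ℂ]^n V) : ℂ :=
  conj (exteriorPower.alternatingMapLinearEquiv (extAlt η) ξ)

theorem extInner_ιMulti (x y : Fin n → V) :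
    extInner (exteriorPower.ιMulti ℂ n x) (exteriorPower.ιMulti ℂ n y) =
      Matrix.det (Matrix.of fun i j => inner ℂ (x j) (y i)) := by
  simp [extInner, extAlt]

theorem extAlt_add (η η' : ⋀[ℂ]^n V) : extAlt (η + η') = extAlt η + extAlt η' := by
  ext x; simp [extAlt]

theorem extAlt_smul (c : ℂ) (η : ⋀[ℂ]^n V) : extAlt (c • η) = conj c • extAlt η := by
  ext x; simp [extAlt]

theorem extInner_add_left (ξ ξ' η : ⋀[ℂ]^n V) :
    extInner (ξ + ξ') η = extInner ξ η + extInner ξ' η := by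
  simp [extInner]

theorem extInner_smul_left (c : ℂ) (ξ η : ⋀[ℂ]^n V) :
    extInner (c • ξ) η = conj c * extInner ξ η := by
  simp [extInner]

theorem extInner_add_right (ξ η η' : ⋀[ℂ]^n V) :
    extInner ξ (η + η') = extInner ξ η + extInner ξ η' := by
  simp [extInner, extAlt_add]

theorem extInner_smul_right (c : ℂ) (ξ η : ⋀[ℂ]^n V) :
    extInner ξ (c • η) = c * extInner ξ η := by
  simp [extInner, extAlt_smul]

theorem extInner_sum_left {ι : Type*} (s : Finset ι) (f : ι → ⋀[ℂ]^n V) (η : ⋀[ℂ]^n V) :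
    extInner (∑ i ∈ s, f i) η = ∑ i ∈ s, extInner (f i) η := by
  simp [extInner]

theorem extInner_sum_right {ι : Type*} (s : Finset ι) (ξ : ⋀[ℂ]^n V) (f : ι → ⋀[ℂ]^n V) :
    extInner ξ (∑ i ∈ s, f i) = ∑ i ∈ s, extInner ξ (f i) := by
  classical
  induction s using Finset.induction_on with
  | empty => simpa using extInner_smul_right 0 ξ 0
  | insert a s ha ih => rw [Finset.sum_insert ha, Finset.sum_insert ha, extInner_add_right, ih]

theorem extInner_family {ι : Type*} [LinearOrder ι] {v : ι → V} (hv : Orthonormal ℂ v)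
    (s t : Set.powersetCard ι n) :
    extInner (exteriorPower.ιMulti_family ℂ n v s) (exteriorPower.ιMulti_family ℂ n v t) =
      if s = t then 1 else 0 := by
  simp only [exteriorPower.ιMulti_family]
  rw [extInner_ιMulti]
  split_ifs with h
  · subst h
    have : (Matrix.of fun i j => inner ℂ
        ((v ∘ Set.powersetCard.ofFinEmbEquiv.symm s) j)
        ((v ∘ Set.powersetCard.ofFinEmbEquiv.symm s) i)) = (1 : Matrix (Fin n) (Fin n) ℂ) := by
      ext i j
      have h2 := (hv.comp _ (RelEmbedding.injective (Set.powersetCard.ofFinEmbEquiv.symm s)))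
      rw [orthonormal_iff_ite] at h2
      rw [Matrix.of_apply, h2, Matrix.one_apply]
      simp only [eq_comm]
    rw [this, Matrix.det_one]
  · obtain ⟨x, hxt, hxs⟩ := (Set.powersetCard.exists_mem_notMem_iff_ne t s).mp (.symm h)
    simp only [Set.mem_range, not_exists,
      ← Set.powersetCard.mem_range_ofFinEmbEquiv_symm_iff_mem] at hxs hxt
    obtain ⟨i, rfl⟩ := hxt
    exact Matrix.det_eq_zero_of_row_eq_zero i (fun j => hv.inner_eq_zero (hxs j))

theorem extInner_eq_sum {ι : Type*} [Fintype ι] [LinearOrder ι] (e : OrthonormalBasis ι ℂ V)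
    (ξ η : ⋀[ℂ]^n V) :
    extInner ξ η = ∑ s, conj ((e.toBasis.exteriorPower n).repr ξ s) *
      (e.toBasis.exteriorPower n).repr η s := by
  classical
  conv_lhs =>
    rw [← (e.toBasis.exteriorPower n).sum_repr ξ, ← (e.toBasis.exteriorPower n).sum_repr η]
  simp only [extInner_sum_left, extInner_sum_right, extInner_smul_left, extInner_smul_right,
    exteriorPower.coe_basis, OrthonormalBasis.coe_toBasis, extInner_family e.orthonormal]
  simp [mul_comm]

instance extCore [FiniteDimensional ℂ V] : InnerProductSpace.Core ℂ (⋀[ℂ]^n V) where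
  inner ξ η := extInner ξ η
  conj_inner_symm ξ η := by
    simp only [extInner_eq_sum (stdOrthonormalBasis ℂ V), map_sum, map_mul, Complex.conj_conj]
    exact Finset.sum_congr rfl fun _ _ => mul_comm _ _
  add_left := extInner_add_left
  smul_left ξ η c := extInner_smul_left c ξ η
  re_inner_nonneg ξ := by
    rw [extInner_eq_sum (stdOrthonormalBasis ℂ V), map_sum]
    refine Finset.sum_nonneg fun s _ => ?_
    rw [← Complex.normSq_eq_conj_mul_self]
    simpa using Complex.normSq_nonneg _
  definite ξ h := by
    rw [extInner_eq_sum (stdOrthonormalBasis ℂ V)] at h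
    simp only [← Complex.normSq_eq_conj_mul_self] at h
    norm_cast at h
    rw [Finset.sum_eq_zero_iff_of_nonneg (fun _ _ => Complex.normSq_nonneg _)] at h
    apply Module.Basis.ext_elem ((stdOrthonormalBasis ℂ V).toBasis.exteriorPower n)
    simpa using h

instance (priority := 50) extNormed [FiniteDimensional ℂ V] : NormedAddCommGroup (⋀[ℂ]^n V) :=
  InnerProductSpace.Core.toNormedAddCommGroup (𝕜 := ℂ)

/-- The induced Hermitian inner product on `⋀ⁿ V`. -/
instance extInnerProductSpace [FiniteDimensional ℂ V] : InnerProductSpace ℂ (⋀[ℂ]^n V) :=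
  InnerProductSpace.ofCore _

theorem inner_ιMulti [FiniteDimensional ℂ V] (x y : Fin n → V) :
    inner ℂ (exteriorPower.ιMulti ℂ n x) (exteriorPower.ιMulti ℂ n y) =
      Matrix.det (Matrix.of fun i j => inner ℂ (x j) (y i)) :=
  extInner_ιMulti x y

end ExteriorPower

/-! ## Hermitian inner product on the dual -/

/-- The Hermitian inner product on the dual for which the conjugate linear Riesz isomorphism
is isometric. -/
instance dualInnerProductSpace {V : Type*} [NormedAddCommGroup V] [InnerProductSpace ℂ V]
    [CompleteSpace V] : InnerProductSpace ℂ (StrongDual ℂ V) where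
  inner φ ψ := inner ℂ ((InnerProductSpace.toDual ℂ V).symm ψ)
    ((InnerProductSpace.toDual ℂ V).symm φ)
  norm_sq_eq_re_inner φ := by rw [inner_self_eq_norm_sq, LinearIsometryEquiv.norm_map]
  conj_inner_symm _ _ := inner_conj_symm _ _
  add_left _ _ _ := by rw [map_add, inner_add_right]
  smul_left _ _ _ := by rw [LinearIsometryEquiv.map_smulₛₗ, inner_smul_right]

instance isClosed_of_finiteDimensional {V : Type*} [NormedAddCommGroup V]
    [InnerProductSpace ℂ V] [FiniteDimensional ℂ V] (S : Submodule ℂ V) :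
    IsClosed (S : Set V) :=
  S.closed_of_finiteDimensional

/-! ## The Horrocks–Mumford bundle with its natural metric -/

/-- `ℂ⁵` with the standard Hermitian inner product. -/
def C5 : Type := EuclideanSpace ℂ (Fin 5)

instance normedC5 : NormedAddCommGroup C5 := inferInstanceAs (NormedAddCommGroup (EuclideanSpace ℂ (Fin 5)))

instance innerC5 : InnerProductSpace ℂ C5 :=
  inferInstanceAs (InnerProductSpace ℂ (EuclideanSpace ℂ (Fin 5)))

instance finiteC5 : FiniteDimensional ℂ C5 :=
  inferInstanceAs (FiniteDimensional ℂ (EuclideanSpace ℂ (Fin 5)))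

/-- The standard orthonormal basis of `ℂ⁵`. -/
def stdBasis : OrthonormalBasis (Fin 5) ℂ C5 := EuclideanSpace.basisFun (Fin 5) ℂ

/-- Complex projective 4-space, the space of lines in `ℂ⁵`. -/
abbrev P4 : Type := ℙ ℂ C5

/-- The standard basis vector `eᵢ` of `ℂ⁵`, with `i` taken modulo 5. -/
abbrev e (i : Fin 5) : C5 := stdBasis i

/-- The fibre at `p` of `Q = T(-1) = (ℂ⁵ ⊗ 𝒪) / 𝒪(-1)`, with the quotient metric. -/
def Q (p : P4) : Type := C5 ⧸ p.submodule

instance normedQ (p : P4) : NormedAddCommGroup (Q p) :=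
  inferInstanceAs (NormedAddCommGroup (C5 ⧸ p.submodule))

instance innerQ (p : P4) : InnerProductSpace ℂ (Q p) :=
  inferInstanceAs (InnerProductSpace ℂ (C5 ⧸ p.submodule))

instance finiteQ (p : P4) : FiniteDimensional ℂ (Q p) :=
  inferInstanceAs (FiniteDimensional ℂ (C5 ⧸ p.submodule))

/-- The projection `π(p) : ℂ⁵ → Q(p)`. -/
def proj (p : P4) : C5 →ₗ[ℂ] Q p := p.submodule.mkQ

/-- The map `⋀²π(p) : ⋀² ℂ⁵ → ⋀² Q(p)` induced by the projection `π(p) : ℂ⁵ → Q(p)`. -/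
def ext2Proj (p : P4) : ⋀[ℂ]^2 C5 →ₗ[ℂ] ⋀[ℂ]^2 (Q p) :=
  exteriorPower.map 2 (proj p)

/-- `a₊(eᵢ) = eᵢ₊₂ ∧ eᵢ₊₃`. -/
def aPlus : C5 →ₗ[ℂ] ⋀[ℂ]^2 C5 :=
  stdBasis.toBasis.constr ℂ fun i =>
    exteriorPower.ιMulti ℂ 2 ![e (i + 2), e (i + 3)]

/-- `a₋(eᵢ) = eᵢ₊₁ ∧ eᵢ₊₄`. -/
def aMinus : C5 →ₗ[ℂ] ⋀[ℂ]^2 C5 :=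
  stdBasis.toBasis.constr ℂ fun i =>
    exteriorPower.ιMulti ℂ 2 ![e (i + 1), e (i + 4)]

/-- The fibre at `p` of `⋀²Q ⊕ ⋀²Q`, the two summands being orthogonal. -/
abbrev M (p : P4) : Type := WithLp 2 (⋀[ℂ]^2 (Q p) × ⋀[ℂ]^2 (Q p))

/-- The exterior product `⋀² V × ⋀² V → ⋀⁴ V`. -/
def wedge22 (V : Type*) [AddCommGroup V] [Module ℂ V] :
    ⋀[ℂ]^2 V →ₗ[ℂ] ⋀[ℂ]^2 V →ₗ[ℂ] ⋀[ℂ]^4 V :=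
  LinearMap.mk₂ ℂ
    (fun ξ η => ⟨(ξ : ExteriorAlgebra ℂ V) * η, by
      have h := Submodule.mul_mem_mul ξ.2 η.2
      rwa [← pow_add] at h⟩)
    (fun ξ ξ' η => Subtype.ext (by simp [add_mul]))
    (fun c ξ η => Subtype.ext (by simp))
    (fun ξ η η' => Subtype.ext (by simp [mul_add]))
    (fun c ξ η => Subtype.ext (by simp))

/-- The monad map `a(p) : ℂ⁵ → ⋀²Q(p) ⊕ ⋀²Q(p)`. -/
def a (p : P4) : C5 →ₗ[ℂ] M p :=
  (WithLp.linearEquiv 2 ℂ (⋀[ℂ]^2 (Q p) × ⋀[ℂ]^2 (Q p))).symm.toLinearMap ∘ₗ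
    ((ext2Proj p ∘ₗ aPlus).prod (ext2Proj p ∘ₗ aMinus))

/-- The monad map `b(p) : ⋀²Q(p) ⊕ ⋀²Q(p) → Hom(ℂ⁵, ⋀⁴Q(p)) = (ℂ⁵)* ⊗ ⋀⁴Q(p)`, which is
`b(p)(ξ, η)(v) = -η ∧ ⋀²π(p)(a₊ v) + ξ ∧ ⋀²π(p)(a₋ v)`. -/
def b (p : P4) : M p →ₗ[ℂ] C5 →ₗ[ℂ] ⋀[ℂ]^4 (Q p) :=
  (-((wedge22 (Q p)).compl₂ (ext2Proj p ∘ₗ aPlus) ∘ₗ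
      LinearMap.snd ℂ (⋀[ℂ]^2 (Q p)) (⋀[ℂ]^2 (Q p))) +
    (wedge22 (Q p)).compl₂ (ext2Proj p ∘ₗ aMinus) ∘ₗ
      LinearMap.fst ℂ (⋀[ℂ]^2 (Q p)) (⋀[ℂ]^2 (Q p))) ∘ₗ
    (WithLp.linearEquiv 2 ℂ (⋀[ℂ]^2 (Q p) × ⋀[ℂ]^2 (Q p))).toLinearMap

theorem aPlus_e (i : Fin 5) :
    aPlus (e i) = exteriorPower.ιMulti ℂ 2 ![e (i + 2), e (i + 3)] := by
  simp only [aPlus, e]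
  rw [← OrthonormalBasis.coe_toBasis, Module.Basis.constr_basis]

theorem aMinus_e (i : Fin 5) :
    aMinus (e i) = exteriorPower.ιMulti ℂ 2 ![e (i + 1), e (i + 4)] := by
  simp only [aMinus, e]
  rw [← OrthonormalBasis.coe_toBasis, Module.Basis.constr_basis]

theorem coe_ext2Proj (p : P4) (x y : C5) :
    ((ext2Proj p (exteriorPower.ιMulti ℂ 2 ![x, y]) : ⋀[ℂ]^2 (Q p)) : ExteriorAlgebra ℂ (Q p)) =
      ExteriorAlgebra.ι ℂ (proj p x) * ExteriorAlgebra.ι ℂ (proj p y) := by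
  simp [ext2Proj, exteriorPower.map_apply_ιMulti, ExteriorAlgebra.ιMulti_apply]
  rfl

/-- The image of `a` is contained in the kernel of `b`. -/
theorem b_comp_a (p : P4) : b p ∘ₗ a p = 0 := by
  refine stdBasis.toBasis.ext fun i => stdBasis.toBasis.ext fun j => Subtype.ext ?_
  rw [OrthonormalBasis.coe_toBasis]
  change ((b p (a p (e i)) (e j) : ⋀[ℂ]^4 (Q p)) : ExteriorAlgebra ℂ (Q p)) = 0
  have sq : ∀ x : Q p, ExteriorAlgebra.ι ℂ x * ExteriorAlgebra.ι ℂ x = 0 := fun x => by simp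
  have sq' : ∀ (x : Q p) (w), ExteriorAlgebra.ι ℂ x * (ExteriorAlgebra.ι ℂ x * w) = 0 :=
    fun x w => by rw [← mul_assoc, sq, zero_mul]
  have sw : ∀ i j : Fin 5, ExteriorAlgebra.ι ℂ (proj p (e i)) * ExteriorAlgebra.ι ℂ (proj p (e j)) =
      -(ExteriorAlgebra.ι ℂ (proj p (e j)) * ExteriorAlgebra.ι ℂ (proj p (e i))) := fun i j => by
    rw [eq_neg_iff_add_eq_zero]
    exact ExteriorAlgebra.ι_add_mul_swap _ _
  have sw' : ∀ (i j : Fin 5) (w),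
      ExteriorAlgebra.ι ℂ (proj p (e i)) * (ExteriorAlgebra.ι ℂ (proj p (e j)) * w) =
      -(ExteriorAlgebra.ι ℂ (proj p (e j)) * (ExteriorAlgebra.ι ℂ (proj p (e i)) * w)) :=
    fun i j w => by rw [← mul_assoc, sw, neg_mul, mul_assoc]
  simp only [b, a, wedge22]
  simp [aPlus_e, aMinus_e, coe_ext2Proj]
  fin_cases i <;> fin_cases j <;> simp [mul_assoc, sq, sq', sw 2 0, sw 4 0, sw 2 1, sw 3 1,
    sw 4 1, sw 3 2, sw 4 2, sw 4 3, sw' 1 0, sw' 2 0, sw' 3 0, sw' 4 0, sw' 2 1, sw' 3 1, sw' 4 1,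
    sw' 3 2, sw' 4 2, sw' 4 3]

/-- The fibre at `p` of `ker b`, with the restricted metric. -/
def KerB (p : P4) : Type := LinearMap.ker (b p)

instance normedKerB (p : P4) : NormedAddCommGroup (KerB p) :=
  inferInstanceAs (NormedAddCommGroup (LinearMap.ker (b p)))

instance innerKerB (p : P4) : InnerProductSpace ℂ (KerB p) :=
  inferInstanceAs (InnerProductSpace ℂ (LinearMap.ker (b p)))

instance finiteKerB (p : P4) : FiniteDimensional ℂ (KerB p) :=
  inferInstanceAs (FiniteDimensional ℂ (LinearMap.ker (b p)))

/-- The inclusion `ker b(p) → ⋀²Q(p) ⊕ ⋀²Q(p)`. -/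
def kerIncl (p : P4) : KerB p →ₗ[ℂ] M p := (LinearMap.ker (b p)).subtype

/-- The subspace `im a(p)` of `ker b(p)`, which contains it by `b_comp_a`. -/
def imA (p : P4) : Submodule ℂ (KerB p) := (LinearMap.range (a p)).comap (kerIncl p)

/-- The fibre at `p` of `E(-2) = ker b / im a`, with the quotient metric `h`. -/
def EMinus2 (p : P4) : Type := KerB p ⧸ imA p

instance normedEMinus2 (p : P4) : NormedAddCommGroup (EMinus2 p) :=
  inferInstanceAs (NormedAddCommGroup (KerB p ⧸ imA p))

instance innerEMinus2 (p : P4) : InnerProductSpace ℂ (EMinus2 p) :=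
  inferInstanceAs (InnerProductSpace ℂ (KerB p ⧸ imA p))

/-- The projection `ker b(p) → E(-2)(p)`. -/
def kerProj (p : P4) : KerB p →ₗ[ℂ] EMinus2 p := (imA p).mkQ

/-- The fibre at `p` of `𝒪(1)`, the dual of the tautological line `𝒪(-1)(p) ⊆ ℂ⁵`, with the dual
of the restricted metric. -/
def O1 (p : P4) : Type := StrongDual ℂ p.submodule

instance normedO1 (p : P4) : NormedAddCommGroup (O1 p) :=
  inferInstanceAs (NormedAddCommGroup (StrongDual ℂ p.submodule))

instance innerO1 (p : P4) : InnerProductSpace ℂ (O1 p) :=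
  inferInstanceAs (InnerProductSpace ℂ (StrongDual ℂ p.submodule))

/-- The value at `p` of the section of `𝒪(1)` given by the homogeneous coordinate `xᵢ`. -/
def coordSection (i : Fin 5) (p : P4) : O1 p :=
  (LinearMap.toContinuousLinearMap (stdBasis.toBasis.coord i ∘ₗ p.submodule.subtype) :
    StrongDual ℂ p.submodule)

/-- The fibre at `p` of the Horrocks–Mumford bundle `E = E(-2) ⊗ 𝒪(2)`, `𝒪(2) = 𝒪(1) ⊗ 𝒪(1)`.
Its inner product (the tensor product one) is the natural metric `h₁`. -/
abbrev E (p : P4) : Type := EMinus2 p ⊗[ℂ] (O1 p ⊗[ℂ] O1 p)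

/-! ## Affine charts and the holomorphic structure of `E` -/

/-- The vector `(z₀, …, 1, …, z₃)` of `ℂ⁵` with `1` in position `i`. -/
def affineLift (i : Fin 5) (z : Fin 4 → ℂ) : C5 :=
  stdBasis.repr.symm (WithLp.toLp 2 (i.insertNth (1 : ℂ) z))

theorem affineLift_ne_zero (i : Fin 5) (z : Fin 4 → ℂ) : affineLift i z ≠ 0 := by
  intro h
  have h1 : (stdBasis.repr (affineLift i z)) i = 1 := by simp [affineLift]
  rw [h] at h1
  simp at h1

/-- The standard parametrization `ℂ⁴ → Uᵢ = {xᵢ ≠ 0} ⊆ ℙ₄`. -/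
def chart (i : Fin 5) (z : Fin 4 → ℂ) : P4 :=
  Projectivization.mk ℂ (affineLift i z) (affineLift_ne_zero i z)

/-- Holomorphic sections of `E` over the open set `chart i '' V`. Here `𝒪(2)` is trivialized over
`Uᵢ` by `xᵢ ⊗ xᵢ`, and a section of `E(-2) = ker b / im a` is holomorphic if locally it lifts to
a holomorphic section of `ker b ⊆ ⋀²Q ⊕ ⋀²Q`, itself the image of a holomorphic
function with values in `⋀²ℂ⁵ ⊕ ⋀²ℂ⁵`. -/
def IsHolomorphicSection (i : Fin 5) (V : Set (Fin 4 → ℂ))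
    (s : ∀ z : Fin 4 → ℂ, E (chart i z)) : Prop :=
  ∀ z₀ ∈ V, ∃ U ⊆ V, IsOpen U ∧ z₀ ∈ U ∧
    ∃ ξ η : (Fin 4 → ℂ) → ⋀[ℂ]^2 C5, DifferentiableOn ℂ ξ U ∧ DifferentiableOn ℂ η U ∧
      ∀ z ∈ U, ∃ k : KerB (chart i z),
        kerIncl (chart i z) k =
          WithLp.toLp 2 (ext2Proj (chart i z) (ξ z), ext2Proj (chart i z) (η z)) ∧
        s z = kerProj (chart i z) k ⊗ₜ[ℂ]
          (coordSection i (chart i z) ⊗ₜ[ℂ] coordSection i (chart i z))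

/-! ## Hermitian–Einstein metrics with respect to the Fubini–Study metric -/

/-- The Wirtinger derivative `∂/∂z_α`. -/
def dz (α : Fin 4) (f : (Fin 4 → ℂ) → ℂ) (z : Fin 4 → ℂ) : ℂ :=
  (1 / 2) * (fderiv ℝ f z (Pi.single α 1) - Complex.I * fderiv ℝ f z (Pi.single α Complex.I))

/-- The Wirtinger derivative `∂/∂z̄_β`. -/
def dzbar (β : Fin 4) (f : (Fin 4 → ℂ) → ℂ) (z : Fin 4 → ℂ) : ℂ :=
  (1 / 2) * (fderiv ℝ f z (Pi.single β 1) + Complex.I * fderiv ℝ f z (Pi.single β Complex.I))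

/-- The coefficients `g_{αβ} = δ_{αβ} / n - z̄_α z_β / n²`, `n = 1 + ‖z‖²`, of the Fubini–Study
metric in an affine chart. -/
def fubiniStudy (z : Fin 4 → ℂ) : Matrix (Fin 4) (Fin 4) ℂ :=
  Matrix.of fun α β => (if α = β then 1 else 0) / (1 + ∑ k, (‖z k‖ : ℂ) ^ 2) -
    conj (z α) * z β / (1 + ∑ k, (‖z k‖ : ℂ) ^ 2) ^ 2

/-- The coefficient matrix of `dz_α ∧ dz̄_β` in the Chern curvature `F = ∂̄(∂H · H⁻¹)` of the
Hermitian metric with matrix `H_{kl} = h(s_k, s_l)` in a holomorphic frame `s`. -/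
def chernCurvature {r : ℕ} (H : (Fin 4 → ℂ) → Matrix (Fin r) (Fin r) ℂ) (α β : Fin 4)
    (z : Fin 4 → ℂ) : Matrix (Fin r) (Fin r) ℂ :=
  -((Matrix.of fun k l => dz α (dzbar β fun w => H w k l) z) * (H z)⁻¹) +
    (Matrix.of fun k l => dz α (fun w => H w k l) z) * (H z)⁻¹ *
      (Matrix.of fun k l => dzbar β (fun w => H w k l) z) * (H z)⁻¹

/-- The mean curvature `K = ∑ g^{βα} F_{αβ}`, where `(g^{αβ})` is the inverse of `(g_{αβ})`. -/
def meanCurvature {r : ℕ} (H : (Fin 4 → ℂ) → Matrix (Fin r) (Fin r) ℂ) (z : Fin 4 → ℂ) :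
    Matrix (Fin r) (Fin r) ℂ :=
  ∑ α, ∑ β, (fubiniStudy z)⁻¹ β α • chernCurvature H α β z

/-- Let `F` be a rank `r` holomorphic vector bundle on `ℙ₄` with Hermitian metric given by the
inner products of its fibres, and with `Hol i V s` saying that `s` is a holomorphic section over
`chart i '' V`. The metric is Hermitian–Einstein for the Fubini–Study metric if its mean
curvature is `c · id` for a real constant `c`, i.e. has the matrix `c · 1` in all local holomorphic
frames. (Inner products are conjugate linear in the first argument.) -/
def IsHermitianEinstein (F : P4 → Type) [∀ p, NormedAddCommGroup (F p)]
    [∀ p, InnerProductSpace ℂ (F p)] (r : ℕ)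
    (Hol : ∀ i : Fin 5, Set (Fin 4 → ℂ) → (∀ z : Fin 4 → ℂ, F (chart i z)) → Prop) : Prop :=
  ∃ c : ℝ, ∀ (i : Fin 5) (V : Set (Fin 4 → ℂ)) (s : Fin r → ∀ z : Fin 4 → ℂ, F (chart i z)),
    IsOpen V → (∀ k, Hol i V (s k)) →
    (∀ z ∈ V, LinearIndependent ℂ (fun k => s k z) ∧
      Submodule.span ℂ (Set.range fun k => s k z) = ⊤) →
    ∀ z ∈ V, meanCurvature (fun w => Matrix.of fun k l => inner ℂ (s l w) (s k w)) z =
      (c : ℂ) • (1 : Matrix (Fin r) (Fin r) ℂ)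

end HorrocksMumford

end

/-!
The mean curvature of the natural metric is computed at the point `(1 : 2 : 0 : 0 : 0)` and found to
have two different eigenvalues.

Over the chart `U₀`, with `x = (1, z)`, the map `ξ ↦ x ∧ ξ` embeds `⋀²Q` holomorphically into the
trivial bundle `⋀³ℂ⁵`, and it multiplies the metric by `|x|²` (`inner_lift`). The metric of `E` is
therefore `|x|⁻⁶` times a metric `h'`, the factors being `|x|⁻²` from this embedding and `|x|⁻⁴`
from `𝒪(2)`; here `h'` is the metric of a subquotient of a flat bundle: its matrix is formed by the
products of the components of sections `φₖ` orthogonal to the columns `Aᵢ` of the monad map `a`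
(`schurMat`, `inner_eSection`). A conformal change by a function adds a multiple of the identity to
the mean curvature (`meanCurvature_smul`), so it is enough that the mean curvature of `h'` is not
scalar.

The frame `φ₁, φ₂` is chosen normal at the point in a strong sense: `φₖ` is orthogonal to the `Aᵢ`,
and `∂φₖ` is orthogonal to the `Aᵢ` and to the `φₗ`. Then the first derivatives of the matrix `H`
of `h'` vanish, the mean curvature is minus the Laplacian of `H`, times `H⁻¹`
(`meanCurvature_mul_of_dz_eq_zero`), and the second derivatives of `H` are `⟨∂φₖ, ∂φₗ⟩` minus a
term given by the second fundamental form of the span of the `Aᵢ` (`dz_dzbar_schurMat`). These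
involve only the values and first derivatives of polynomials at one point, and give the eigenvalues
`-2770/1323` and `-2522/1323` (`meanCurvature_frameMat_ne`).

That `φ₁, φ₂` is a frame of `E` near the point follows from the invertibility of the matrix of `h'`
and from `rank (ker b / im a) ≤ 2`, which is read off from the equations of `ker b`
(`finrank_KerB_le`) and the injectivity of `a` (`a_injective`).
-/

noncomputable section

namespace HorrocksMumford

open scoped LinearAlgebra.Projectivization TensorProduct ComplexConjugate Topology
open Filter

/-! ### Wirtinger calculus -/

section Wirtinger

variable {f g : (Fin 4 → ℂ) → ℂ} {z : Fin 4 → ℂ} (α β : Fin 4)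

theorem dz_congr (h : f =ᶠ[𝓝 z] g) : dz α f z = dz α g z := by
  simp only [dz, h.fderiv_eq]

theorem dzbar_congr (h : f =ᶠ[𝓝 z] g) : dzbar β f z = dzbar β g z := by
  simp only [dzbar, h.fderiv_eq]

theorem dzbar_eventuallyEq (h : f =ᶠ[𝓝 z] g) : dzbar β f =ᶠ[𝓝 z] dzbar β g := by
  filter_upwards [h.eventuallyEq_nhds] with w hw using dzbar_congr β hw

theorem dz_dzbar_congr (h : f =ᶠ[𝓝 z] g) : dz α (dzbar β f) z = dz α (dzbar β g) z :=
  dz_congr α (dzbar_eventuallyEq β h)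

theorem dz_const (c : ℂ) : dz α (fun _ => c) z = 0 := by simp [dz]

theorem dz_add (hf : DifferentiableAt ℝ f z) (hg : DifferentiableAt ℝ g z) :
    dz α (fun w => f w + g w) z = dz α f z + dz α g z := by
  simp only [dz, fderiv_fun_add hf hg, add_apply]; ring

theorem dz_sub (hf : DifferentiableAt ℝ f z) (hg : DifferentiableAt ℝ g z) :
    dz α (fun w => f w - g w) z = dz α f z - dz α g z := by
  simp only [dz, fderiv_fun_sub hf hg, sub_apply]; ring

theorem dzbar_sub (hf : DifferentiableAt ℝ f z) (hg : DifferentiableAt ℝ g z) :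
    dzbar β (fun w => f w - g w) z = dzbar β f z - dzbar β g z := by
  simp only [dzbar, fderiv_fun_sub hf hg, sub_apply]; ring

theorem dz_mul (hf : DifferentiableAt ℝ f z) (hg : DifferentiableAt ℝ g z) :
    dz α (fun w => f w * g w) z = f z * dz α g z + dz α f z * g z := by
  simp only [dz, fderiv_fun_mul hf hg, add_apply,
    smul_apply, smul_eq_mul]
  ring

theorem dzbar_mul (hf : DifferentiableAt ℝ f z) (hg : DifferentiableAt ℝ g z) :
    dzbar β (fun w => f w * g w) z = f z * dzbar β g z + dzbar β f z * g z := by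
  simp only [dzbar, fderiv_fun_mul hf hg, add_apply,
    smul_apply, smul_eq_mul]
  ring

theorem dz_sum {ι : Type*} {s : Finset ι} {F : ι → (Fin 4 → ℂ) → ℂ}
    (h : ∀ i ∈ s, DifferentiableAt ℝ (F i) z) :
    dz α (fun w => ∑ i ∈ s, F i w) z = ∑ i ∈ s, dz α (F i) z := by
  simp only [dz, fderiv_fun_sum h, sum_apply, Finset.mul_sum,
    ← Finset.sum_sub_distrib]

theorem dzbar_sum {ι : Type*} {s : Finset ι} {F : ι → (Fin 4 → ℂ) → ℂ}
    (h : ∀ i ∈ s, DifferentiableAt ℝ (F i) z) :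
    dzbar β (fun w => ∑ i ∈ s, F i w) z = ∑ i ∈ s, dzbar β (F i) z := by
  simp only [dzbar, fderiv_fun_sum h, sum_apply, Finset.mul_sum,
    ← Finset.sum_add_distrib]

theorem fderiv_conj (v : Fin 4 → ℂ) :
    fderiv ℝ (fun w => conj (f w)) z v = conj (fderiv ℝ f z v) := by
  have h : (fun w => conj (f w)) = Complex.conjCLE ∘ f := by ext; simp
  rw [h, ContinuousLinearEquiv.comp_fderiv]
  simp

theorem dz_conj : dz α (fun w => conj (f w)) z = conj (dzbar α f z) := by
  simp only [dz, dzbar, fderiv_conj, map_mul, map_add, Complex.conj_I, map_div₀, map_one,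
    map_ofNat]
  ring

theorem dzbar_conj : dzbar β (fun w => conj (f w)) z = conj (dz β f z) := by
  simp only [dz, dzbar, fderiv_conj, map_mul, map_sub, Complex.conj_I, map_div₀, map_one,
    map_ofNat]
  ring

theorem fderiv_apply_single_I (hf : DifferentiableAt ℂ f z) :
    fderiv ℝ f z (Pi.single α Complex.I) = Complex.I * fderiv ℝ f z (Pi.single α 1) := by
  have h : (Pi.single α Complex.I : Fin 4 → ℂ) = Complex.I • Pi.single α 1 := by
    rw [← Pi.single_smul]; simp
  rw [hf.fderiv_restrictScalars ℝ, h]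
  simp

theorem dz_eq_fderiv (hf : DifferentiableAt ℂ f z) :
    dz α f z = fderiv ℂ f z (Pi.single α 1) := by
  rw [dz, fderiv_apply_single_I α hf, hf.fderiv_restrictScalars ℝ, ← mul_assoc, Complex.I_mul_I]
  simp; ring

theorem dzbar_eq_zero (hf : DifferentiableAt ℂ f z) : dzbar β f z = 0 := by
  rw [dzbar, fderiv_apply_single_I β hf, ← mul_assoc, Complex.I_mul_I]
  ring

theorem eventually_differentiableAt (hf : ContDiffAt ℝ 2 f z) :
    ∀ᶠ w in 𝓝 z, DifferentiableAt ℝ f w := by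
  filter_upwards [hf.eventually (by simp)] with w hw using hw.differentiableAt (by simp)

theorem differentiableAt_dzbar (hf : ContDiffAt ℝ 2 f z) :
    DifferentiableAt ℝ (dzbar β f) z := by
  have h : ContDiffAt ℝ 1 (fderiv ℝ f) z := hf.fderiv_right (by norm_num)
  have h' := h.differentiableAt (by simp)
  unfold dzbar
  fun_prop

theorem dz_dzbar_sub (hf : ContDiffAt ℝ 2 f z) (hg : ContDiffAt ℝ 2 g z) :
    dz α (dzbar β fun w => f w - g w) z = dz α (dzbar β f) z - dz α (dzbar β g) z := by
  rw [← dz_sub α (differentiableAt_dzbar β hf) (differentiableAt_dzbar β hg)]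
  apply dz_congr
  filter_upwards [eventually_differentiableAt hf, eventually_differentiableAt hg] with w h1 h2
    using dzbar_sub β h1 h2

theorem dz_dzbar_sum {ι : Type*} {s : Finset ι} {F : ι → (Fin 4 → ℂ) → ℂ}
    (h : ∀ i ∈ s, ContDiffAt ℝ 2 (F i) z) :
    dz α (dzbar β fun w => ∑ i ∈ s, F i w) z = ∑ i ∈ s, dz α (dzbar β (F i)) z := by
  rw [← dz_sum α fun i hi => differentiableAt_dzbar β (h i hi)]
  apply dz_congr
  filter_upwards [(Finset.eventually_all s).2 fun i hi => eventually_differentiableAt (h i hi)]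
    with w h1 using dzbar_sum β h1

theorem dz_dzbar_mul (hf : ContDiffAt ℝ 2 f z) (hg : ContDiffAt ℝ 2 g z) :
    dz α (dzbar β fun w => f w * g w) z =
      f z * dz α (dzbar β g) z + dz α f z * dzbar β g z + dzbar β f z * dz α g z +
        dz α (dzbar β f) z * g z := by
  have hf1 := hf.differentiableAt (by simp)
  have hg1 := hg.differentiableAt (by simp)
  have hf2 := differentiableAt_dzbar β hf
  have hg2 := differentiableAt_dzbar β hg
  have h : (dzbar β fun w => f w * g w) =ᶠ[𝓝 z]
      fun w => f w * dzbar β g w + dzbar β f w * g w := by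
    filter_upwards [eventually_differentiableAt hf, eventually_differentiableAt hg] with w h1 h2
      using dzbar_mul β h1 h2
  rw [dz_congr α h, dz_add α (hf1.fun_mul hg2) (hf2.fun_mul hg1), dz_mul α hf1 hg2,
    dz_mul α hf2 hg1]
  ring

theorem dz_dzbar_eq_zero (hf : ContDiff ℂ 2 f) : dz α (dzbar β f) z = 0 := by
  have h : dzbar β f = fun _ => 0 := by
    ext w; exact dzbar_eq_zero β (hf.differentiable (by simp) w)
  rw [h, dz_const]

theorem dz_dzbar_conj_eq_zero (hf : ContDiff ℂ 2 f) :
    dz α (dzbar β fun w => conj (f w)) z = 0 := by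
  have hd : ContDiff ℂ 1 (fderiv ℂ f) := hf.fderiv_right (by norm_num)
  have h : (dzbar β fun w => conj (f w)) = fun w => conj (fderiv ℂ f w (Pi.single β 1)) := by
    ext w; rw [dzbar_conj, dz_eq_fderiv β (hf.differentiable (by simp) w)]
  rw [h, dz_conj, dzbar_eq_zero, map_zero]
  have := hd.differentiable (by simp)
  fun_prop

theorem contDiff_conj (hf : ContDiff ℝ 2 f) : ContDiff ℝ 2 fun w => conj (f w) :=
  Complex.conjCLE.contDiff.comp hf

end Wirtinger

/-! ### Gram matrices and the curvature of a quotient metric -/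

section Schur

variable {N : Type*} [Fintype N] {m r : ℕ}

/-- The pointwise Hermitian product of two vector valued functions. -/
def herm (u v : N → (Fin 4 → ℂ) → ℂ) (z : Fin 4 → ℂ) : ℂ := ∑ T, conj (u T z) * v T z

/-- The Gram matrix of the vectors `A₁, …, Aₘ`. -/
def gramMat (A : Fin m → N → (Fin 4 → ℂ) → ℂ) (z : Fin 4 → ℂ) : Matrix (Fin m) (Fin m) ℂ :=
  Matrix.of fun i j => herm (A i) (A j) z

/-- The coefficients of the orthogonal projection of `φ` to the span of the `Aᵢ`. -/
def projCoeff (A : Fin m → N → (Fin 4 → ℂ) → ℂ) (φ : N → (Fin 4 → ℂ) → ℂ) (z : Fin 4 → ℂ) :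
    Fin m → ℂ :=
  (gramMat A z)⁻¹.mulVec fun j => herm (A j) φ z

/-- The matrix of Hermitian products of the components of the `φₖ` orthogonal to the `Aᵢ`, that is,
of the quotient metric. The index order is that of `H_{kl} = h(s_k, s_l)`, where `h` is linear in
its first argument. -/
def schurMat (A : Fin m → N → (Fin 4 → ℂ) → ℂ) (φ : Fin r → N → (Fin 4 → ℂ) → ℂ)
    (z : Fin 4 → ℂ) : Matrix (Fin r) (Fin r) ℂ :=
  Matrix.of fun k l => herm (φ l) (φ k) z -
    ∑ i, conj (herm (A i) (φ l) z) * projCoeff A (φ k) z i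

variable {u v : N → (Fin 4 → ℂ) → ℂ} {z : Fin 4 → ℂ}

theorem contDiff_herm (hu : ∀ T, ContDiff ℂ 2 (u T)) (hv : ∀ T, ContDiff ℂ 2 (v T)) :
    ContDiff ℝ 2 (herm u v) :=
  ContDiff.sum fun T _ => (contDiff_conj ((hu T).restrict_scalars ℝ)).mul
    ((hv T).restrict_scalars ℝ)

theorem dz_herm (α : Fin 4) (hu : ∀ T, ContDiff ℂ 2 (u T)) (hv : ∀ T, ContDiff ℂ 2 (v T)) :
    dz α (herm u v) z = ∑ T, conj (u T z) * dz α (v T) z := by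
  have hu' := fun T => (hu T).restrict_scalars ℝ
  have hv' := fun T => (hv T).restrict_scalars ℝ
  unfold herm
  rw [dz_sum α fun T _ => (((contDiff_conj (hu' T)).mul (hv' T)).differentiable (by simp)) z]
  refine Finset.sum_congr rfl fun T _ => ?_
  rw [dz_mul α ((contDiff_conj (hu' T)).differentiable (by simp) z)
    ((hv' T).differentiable (by simp) z), dz_conj,
    dzbar_eq_zero α ((hu T).differentiable (by simp) z)]
  simp

theorem herm_conj_symm (w : Fin 4 → ℂ) : conj (herm u v w) = herm v u w := by
  simp [herm, mul_comm]

theorem dzbar_herm (α : Fin 4) (hu : ∀ T, ContDiff ℂ 2 (u T)) (hv : ∀ T, ContDiff ℂ 2 (v T)) :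
    dzbar α (herm u v) z = ∑ T, conj (dz α (u T) z) * v T z := by
  have h : herm u v = fun w => conj (herm v u w) := by ext w; rw [herm_conj_symm]
  rw [h, dzbar_conj, dz_herm α hv hu]
  simp [mul_comm]

theorem dz_dzbar_herm (α β : Fin 4) (hu : ∀ T, ContDiff ℂ 2 (u T))
    (hv : ∀ T, ContDiff ℂ 2 (v T)) :
    dz α (dzbar β (herm u v)) z = ∑ T, conj (dz β (u T) z) * dz α (v T) z := by
  have hu' := fun T => (hu T).restrict_scalars ℝ
  have hv' := fun T => (hv T).restrict_scalars ℝ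
  unfold herm
  rw [dz_dzbar_sum α β fun T _ => ((contDiff_conj (hu' T)).mul (hv' T)).contDiffAt]
  refine Finset.sum_congr rfl fun T _ => ?_
  rw [dz_dzbar_mul α β (contDiff_conj (hu' T)).contDiffAt (hv' T).contDiffAt,
    dz_dzbar_eq_zero α β (hv T), dz_dzbar_conj_eq_zero α β (hu T), dzbar_conj, dz_conj,
    dzbar_eq_zero α ((hu T).differentiable (by simp) z)]
  simp

/-- By Cramer's rule. -/
theorem contDiffAt_matrix_inv {G : (Fin 4 → ℂ) → Matrix (Fin m) (Fin m) ℂ}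
    (hG : ∀ i j, ContDiffAt ℝ 2 (fun w => G w i j) z) (hdet : (G z).det ≠ 0) (i j : Fin m) :
    ContDiffAt ℝ 2 (fun w => (G w)⁻¹ i j) z := by
  have hd : ∀ K : (Fin 4 → ℂ) → Matrix (Fin m) (Fin m) ℂ,
      (∀ i j, ContDiffAt ℝ 2 (fun w => K w i j) z) → ContDiffAt ℝ 2 (fun w => (K w).det) z := by
    intro K hK
    simp only [Matrix.det_apply]
    refine ContDiffAt.sum fun σ _ => ?_
    exact (contDiffAt_prod fun i _ => hK _ _).const_smul _
  simp only [Matrix.inv_def, Matrix.smul_apply, Ring.inverse_eq_inv', smul_eq_mul,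
    Matrix.adjugate_apply]
  refine ((hd G hG).inv hdet).mul (hd _ fun k l => ?_)
  by_cases h : k = j
  · subst h; simpa using contDiffAt_const
  · simpa [Matrix.updateRow_ne h] using hG k l

variable {A : Fin m → N → (Fin 4 → ℂ) → ℂ} {φ : Fin r → N → (Fin 4 → ℂ) → ℂ}

theorem contDiffAt_projCoeff (hA : ∀ i T, ContDiff ℂ 2 (A i T)) (hv : ∀ T, ContDiff ℂ 2 (v T))
    (hdet : (gramMat A z).det ≠ 0) (i : Fin m) :
    ContDiffAt ℝ 2 (fun w => projCoeff A v w i) z := by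
  simp only [projCoeff, Matrix.mulVec, dotProduct]
  refine ContDiffAt.sum fun j _ => ContDiffAt.mul ?_ (contDiff_herm (hA j) hv).contDiffAt
  exact contDiffAt_matrix_inv (fun i j => (contDiff_herm (hA i) (hA j)).contDiffAt) hdet i j

theorem eventually_det_gramMat_ne_zero (hA : ∀ i T, ContDiff ℂ 2 (A i T))
    (hdet : (gramMat A z).det ≠ 0) : ∀ᶠ w in 𝓝 z, (gramMat A w).det ≠ 0 := by
  refine ContinuousAt.eventually_ne ?_ hdet
  have : Continuous fun w => (gramMat A w).det :=
    Continuous.matrix_det (continuous_matrix fun i j => (contDiff_herm (hA i) (hA j)).continuous)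
  exact this.continuousAt

/-- The normal equations of the orthogonal projection. -/
theorem gramMat_mulVec_projCoeff (hdet : (gramMat A z).det ≠ 0) (i : Fin m) :
    ∑ j, herm (A i) (A j) z * projCoeff A v z j = herm (A i) v z := by
  have h : (gramMat A z).mulVec (projCoeff A v z) = fun j => herm (A j) v z := by
    rw [projCoeff, Matrix.mulVec_mulVec, Matrix.mul_nonsing_inv _ (isUnit_iff_ne_zero.2 hdet),
      Matrix.one_mulVec]
  exact congrFun h i

theorem contDiffAt_schurMat (hA : ∀ i T, ContDiff ℂ 2 (A i T)) (hφ : ∀ k T, ContDiff ℂ 2 (φ k T))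
    (hdet : (gramMat A z).det ≠ 0) (k l : Fin r) :
    ContDiffAt ℝ 2 (fun w => schurMat A φ w k l) z := by
  refine (contDiff_herm (hφ l) (hφ k)).contDiffAt.sub (ContDiffAt.sum fun i _ => ?_)
  exact (contDiff_conj (contDiff_herm (hA i) (hφ l))).contDiffAt.mul
    (contDiffAt_projCoeff hA (hφ k) hdet i)

theorem projCoeff_eq_zero (h0 : ∀ i, herm (A i) v z = 0) : projCoeff A v z = 0 := by
  rw [projCoeff, show (fun j => herm (A j) v z) = 0 from funext h0, Matrix.mulVec_zero]

/-- The first derivatives of a quotient metric at a point where the frame `φ` is orthogonal to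
the subbundle spanned by the `Aᵢ`. -/
theorem dz_schurMat (α : Fin 4) (hA : ∀ i T, ContDiff ℂ 2 (A i T))
    (hφ : ∀ k T, ContDiff ℂ 2 (φ k T)) (hdet : (gramMat A z).det ≠ 0)
    (h0 : ∀ i k, herm (A i) (φ k) z = 0) (k l : Fin r) :
    dz α (fun w => schurMat A φ w k l) z = ∑ T, conj (φ l T z) * dz α (φ k T) z := by
  have hr := fun i => (contDiff_conj (contDiff_herm (hA i) (hφ l))).differentiable (by simp) z
  have hy := fun i => (contDiffAt_projCoeff hA (hφ k) hdet i).differentiableAt (by simp)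
  simp only [schurMat, Matrix.of_apply]
  rw [dz_sub α ((contDiff_herm (hφ l) (hφ k)).differentiable (by simp) z)
    (DifferentiableAt.fun_sum fun i _ => (hr i).fun_mul (hy i)), dz_herm α (hφ l) (hφ k),
    dz_sum α fun i _ => (hr i).fun_mul (hy i), sub_eq_self]
  refine Finset.sum_eq_zero fun i _ => ?_
  rw [dz_mul α (hr i) (hy i), projCoeff_eq_zero fun i => h0 i k, h0]
  simp

/-- Where `v` is orthogonal to all `Aᵢ`, its projection coefficients have the first derivatives
`G⁻¹ (∂̄ (A* v))`, `G = A* A`. -/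
theorem dzbar_projCoeff (β : Fin 4) (hA : ∀ i T, ContDiff ℂ 2 (A i T))
    (hv : ∀ T, ContDiff ℂ 2 (v T)) (hdet : (gramMat A z).det ≠ 0)
    (h0 : ∀ i, herm (A i) v z = 0) {c : Fin m → ℂ}
    (hc : ∀ i, ∑ j, herm (A i) (A j) z * c j = ∑ T, conj (dz β (A i T) z) * v T z) (i : Fin m) :
    dzbar β (fun w => projCoeff A v w i) z = c i := by
  have hy := fun i => (contDiffAt_projCoeff hA hv hdet i).differentiableAt (by simp)
  have hG := fun i j => ((contDiff_herm (hA i) (hA j)).differentiable (by simp)) z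
  have key : ∀ i, ∑ j, herm (A i) (A j) z * dzbar β (fun w => projCoeff A v w j) z =
      ∑ T, conj (dz β (A i T) z) * v T z := by
    intro i
    rw [← dzbar_herm β (hA i) hv]
    -- Differentiate the normal equations; the derivatives of `G` do not enter, as the
    -- coefficients vanish at `z`.
    have h1 : (fun w => ∑ j, herm (A i) (A j) w * projCoeff A v w j) =ᶠ[𝓝 z] herm (A i) v := by
      filter_upwards [eventually_det_gramMat_ne_zero hA hdet] with w hw
        using gramMat_mulVec_projCoeff hw i
    rw [← dzbar_congr β h1, dzbar_sum β fun j _ => (hG i j).fun_mul (hy j)]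
    refine Finset.sum_congr rfl fun j _ => ?_
    rw [dzbar_mul β (hG i j) (hy j), projCoeff_eq_zero h0]; simp
  have hinj : (gramMat A z).mulVec (fun j => dzbar β (fun w => projCoeff A v w j) z) =
      (gramMat A z).mulVec c := by
    ext i
    exact (key i).trans (hc i).symm
  exact congrFun (Matrix.mulVec_injective_of_isUnit
    ((Matrix.isUnit_iff_isUnit_det _).2 (isUnit_iff_ne_zero.2 hdet)) hinj) i

/-- The second derivatives of a quotient metric at a point where the frame `φ` is orthogonal to
the subbundle spanned by the `Aᵢ` to first order: the second term is the square of the second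
fundamental form of the subbundle. -/
theorem dz_dzbar_schurMat (α β : Fin 4) (hA : ∀ i T, ContDiff ℂ 2 (A i T))
    (hφ : ∀ k T, ContDiff ℂ 2 (φ k T)) (hdet : (gramMat A z).det ≠ 0)
    (h0 : ∀ i k, herm (A i) (φ k) z = 0)
    (h1 : ∀ i k, ∑ T, conj (A i T z) * dz β (φ k T) z = 0) (k l : Fin r) {c : Fin m → ℂ}
    (hc : ∀ i, ∑ j, herm (A i) (A j) z * c j = ∑ T, conj (dz β (A i T) z) * φ k T z) :
    dz α (dzbar β fun w => schurMat A φ w k l) z =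
      ∑ T, conj (dz β (φ l T) z) * dz α (φ k T) z -
        ∑ i, conj (∑ T, conj (dz α (A i T) z) * φ l T z) * c i := by
  have hr := fun i => contDiff_conj (contDiff_herm (hA i) (hφ l))
  have hy := fun i => contDiffAt_projCoeff hA (hφ k) hdet i
  have hs := fun i => (hr i).contDiffAt.mul (hy i)
  simp only [schurMat, Matrix.of_apply]
  rw [dz_dzbar_sub α β (contDiff_herm (hφ l) (hφ k)).contDiffAt (ContDiffAt.sum fun i _ => hs i),
    dz_dzbar_herm α β (hφ l) (hφ k), dz_dzbar_sum α β fun i _ => hs i]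
  congr 1
  refine Finset.sum_congr rfl fun i _ => ?_
  rw [dz_dzbar_mul α β (hr i).contDiffAt (hy i), dzbar_projCoeff β hA (hφ k) hdet
    (fun i => h0 i k) hc, dz_conj, dzbar_herm α (hA i) (hφ l), dzbar_conj, dz_herm β (hA i) (hφ l),
    projCoeff_eq_zero fun i => h0 i k, h0, h1 i l]
  simp

end Schur

/-! ### Mean curvature -/

section MeanCurvature

variable {r : ℕ} {H H' : (Fin 4 → ℂ) → Matrix (Fin r) (Fin r) ℂ} {z : Fin 4 → ℂ}

theorem meanCurvature_congr (h : H =ᶠ[𝓝 z] H') : meanCurvature H z = meanCurvature H' z := by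
  have hkl : ∀ k l, (fun w => H w k l) =ᶠ[𝓝 z] fun w => H' w k l := fun k l => by
    filter_upwards [h] with w hw
    rw [hw]
  simp only [meanCurvature, chernCurvature, h.eq_of_nhds, fun α k l => dz_congr α (hkl k l),
    fun α k l => dzbar_congr α (hkl k l), fun α β k l => dz_dzbar_congr α β (hkl k l)]

/-- A conformal change of the metric by a scalar function changes the Chern curvature by a
multiple of the identity. -/
theorem chernCurvature_smul {f : (Fin 4 → ℂ) → ℂ} (hf : ContDiffAt ℝ 2 f z) (hf0 : f z ≠ 0)
    (hH : ∀ k l, ContDiffAt ℝ 2 (fun w => H w k l) z) (hdet : (H z).det ≠ 0) (α β : Fin 4) :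
    chernCurvature (fun w => f w • H w) α β z = chernCurvature H α β z +
      (-(dz α (dzbar β f) z) / f z + dz α f z * dzbar β f z / f z ^ 2) • 1 := by
  have hf' := hf.differentiableAt (by simp)
  have hH' := fun k l => (hH k l).differentiableAt (by simp)
  have h1 : (Matrix.of fun k l => dz α (fun w => (f w • H w) k l) z) =
      f z • (Matrix.of fun k l => dz α (fun w => H w k l) z) + dz α f z • H z := by
    ext k l
    simp [dz_mul α hf' (hH' k l)]
  have h2 : (Matrix.of fun k l => dzbar β (fun w => (f w • H w) k l) z) =
      f z • (Matrix.of fun k l => dzbar β (fun w => H w k l) z) + dzbar β f z • H z := by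
    ext k l
    simp [dzbar_mul β hf' (hH' k l)]
  have h3 : (Matrix.of fun k l => dz α (dzbar β fun w => (f w • H w) k l) z) =
      f z • (Matrix.of fun k l => dz α (dzbar β fun w => H w k l) z) +
      dz α f z • (Matrix.of fun k l => dzbar β (fun w => H w k l) z) +
      dzbar β f z • (Matrix.of fun k l => dz α (fun w => H w k l) z) +
      dz α (dzbar β f) z • H z := by
    ext k l
    simp [dz_dzbar_mul α β hf (hH k l)]
  have hu : IsUnit (H z).det := isUnit_iff_ne_zero.2 hdet
  have hinv : (f z • H z)⁻¹ = (f z)⁻¹ • (H z)⁻¹ := by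
    refine Matrix.inv_eq_right_inv ?_
    rw [smul_mul_smul_comm, mul_inv_cancel₀ hf0, Matrix.mul_nonsing_inv _ hu, one_smul]
  rw [chernCurvature, chernCurvature, h1, h2, h3, hinv]
  generalize (Matrix.of fun k l => dz α (fun w => H w k l) z) = X
  generalize (Matrix.of fun k l => dzbar β (fun w => H w k l) z) = Y
  generalize (Matrix.of fun k l => dz α (dzbar β fun w => H w k l) z) = Z
  have hm : H z * (H z)⁻¹ = 1 := Matrix.mul_nonsing_inv _ hu
  simp only [add_mul, mul_add, Matrix.smul_mul, Matrix.mul_smul, smul_smul, hm, Matrix.mul_assoc,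
    Matrix.mul_one, Matrix.one_mul]
  match_scalars <;> field_simp <;> ring

theorem meanCurvature_smul {f : (Fin 4 → ℂ) → ℂ} (hf : ContDiffAt ℝ 2 f z) (hf0 : f z ≠ 0)
    (hH : ∀ k l, ContDiffAt ℝ 2 (fun w => H w k l) z) (hdet : (H z).det ≠ 0) :
    ∃ κ : ℂ, meanCurvature (fun w => f w • H w) z = meanCurvature H z + κ • 1 := by
  refine ⟨∑ α, ∑ β, (fubiniStudy z)⁻¹ β α *
    (-(dz α (dzbar β f) z) / f z + dz α f z * dzbar β f z / f z ^ 2), ?_⟩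
  simp only [meanCurvature, chernCurvature_smul hf hf0 hH hdet, smul_add, Finset.sum_add_distrib,
    smul_smul, Finset.sum_smul]

/-- At a point where the first derivatives of the metric vanish, the mean curvature is given by its
complex Laplacian. -/
theorem meanCurvature_mul_of_dz_eq_zero (h : ∀ α k l, dz α (fun w => H w k l) z = 0)
    (hdet : (H z).det ≠ 0) :
    meanCurvature H z * H z =
      -∑ α, ∑ β, (fubiniStudy z)⁻¹ β α •
        Matrix.of fun k l => dz α (dzbar β fun w => H w k l) z := by
  have h0 : ∀ α, (Matrix.of fun k l => dz α (fun w => H w k l) z) = 0 := fun α => by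
    ext k l; exact h α k l
  simp only [meanCurvature, chernCurvature, h0, Matrix.zero_mul, add_zero, Finset.sum_mul,
    Matrix.smul_mul, neg_mul, Matrix.mul_assoc,
    Matrix.nonsing_inv_mul _ (isUnit_iff_ne_zero.2 hdet), Matrix.mul_one, smul_neg,
    Finset.sum_neg_distrib]

end MeanCurvature

/-! ### The fibre metrics in coordinates -/

/-- The quotient metric, computed by a representative of one of the two classes that is orthogonal
to the subspace. -/
theorem inner_mkQ {V : Type*} [NormedAddCommGroup V] [InnerProductSpace ℂ V] [FiniteDimensional ℂ V]
    (S : Submodule ℂ V) {x y w : V} (hw : w ∈ S) (hy : y - w ∈ Sᗮ) :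
    inner ℂ (S.mkQ x) (S.mkQ y) = inner ℂ x (y - w) := by
  have h1 : S.mkQ y = S.mkQ (y - w) := by
    rw [map_sub, (Submodule.Quotient.mk_eq_zero S).2 hw |> (show S.mkQ w = 0 from ·), sub_zero]
  obtain ⟨x₁, hx₁, x₂, hx₂, rfl⟩ := S.exists_add_mem_mem_orthogonal x
  have h2 : S.mkQ (x₁ + x₂) = S.mkQ x₂ := by
    rw [map_add, show S.mkQ x₁ = 0 from (Submodule.Quotient.mk_eq_zero S).2 hx₁, zero_add]
  rw [h1, h2, inner_add_left, S.inner_right_of_mem_orthogonal hx₁ hy, zero_add]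
  exact Submodule.Quotient.inner_mk_mk S _ _ hx₂ hy

/-- `|(1, z)|² = 1 + ‖z‖²`, written as a polynomial in `z` and `z̄`. -/
def nrm (z : Fin 4 → ℂ) : ℂ := 1 + ∑ k, z k * conj (z k)

theorem nrm_eq (z : Fin 4 → ℂ) : nrm z = ((1 + ∑ k, ‖z k‖ ^ 2 : ℝ) : ℂ) := by
  simp [nrm, Complex.mul_conj, Complex.normSq_eq_norm_sq]

theorem nrm_ne_zero (z : Fin 4 → ℂ) : nrm z ≠ 0 := by
  rw [nrm_eq]
  norm_cast
  positivity

theorem e_repr (x : C5) (i : Fin 5) : inner ℂ (e i) x = stdBasis.repr x i :=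
  (stdBasis.repr_apply_apply x i).symm

theorem inner_e_affineLift (i : Fin 5) (z : Fin 4 → ℂ) :
    inner ℂ (e i) (affineLift 0 z) = (Fin.cons 1 z : Fin 5 → ℂ) i := by
  rw [e_repr]; simp [affineLift]

theorem affineLift_zero_eq (z : Fin 4 → ℂ) : affineLift 0 z = e 0 + ∑ k, z k • e k.succ := by
  rw [← stdBasis.sum_repr (affineLift 0 z), Fin.sum_univ_succ]
  simp [affineLift]

theorem inner_affineLift_self (z : Fin 4 → ℂ) :
    inner ℂ (affineLift 0 z) (affineLift 0 z) = nrm z := by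
  conv_lhs => arg 2; rw [affineLift_zero_eq]
  rw [inner_add_left, sum_inner]
  simp only [inner_smul_left, inner_e_affineLift, nrm]
  simp [mul_comm]

theorem submodule_chart (z : Fin 4 → ℂ) : (chart 0 z).submodule = ℂ ∙ affineLift 0 z := by
  simp [chart]

theorem inner_proj (z : Fin 4 → ℂ) (u v : C5) :
    inner ℂ (proj (chart 0 z) u) (proj (chart 0 z) v) = inner ℂ u v -
      inner ℂ u (affineLift 0 z) * inner ℂ (affineLift 0 z) v / nrm z := by
  have hw : (inner ℂ (affineLift 0 z) v / nrm z) • affineLift 0 z ∈ (chart 0 z).submodule := by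
    rw [submodule_chart]; exact Submodule.smul_mem _ _ (Submodule.mem_span_singleton_self _)
  refine (inner_mkQ (chart 0 z).submodule hw ?_).trans ?_
  · rw [submodule_chart, Submodule.mem_orthogonal_singleton_iff_inner_right, inner_sub_right,
      inner_smul_right, inner_affineLift_self, div_mul_cancel₀ _ (nrm_ne_zero z), sub_self]
  · rw [inner_sub_right, inner_smul_right]; ring

/-- The frame `π(e₁), …, π(e₄)` of `Q` over the chart `U₀`. -/
def qFrame (z : Fin 4 → ℂ) (k : Fin 4) : Q (chart 0 z) := proj (chart 0 z) (e k.succ)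

/-- Since `x = e₀ + ∑ zₖ eₖ` is zero in `Q`. -/
theorem proj_e_zero (z : Fin 4 → ℂ) : proj (chart 0 z) (e 0) = -∑ k, z k • qFrame z k := by
  have h : proj (chart 0 z) (affineLift 0 z) = 0 := by
    refine (Submodule.Quotient.mk_eq_zero _).2 ?_
    rw [submodule_chart]; exact Submodule.mem_span_singleton_self _
  rw [affineLift_zero_eq, map_add, map_sum] at h
  simpa [qFrame] using eq_neg_of_add_eq_zero_left h

theorem inner_qFrame (z : Fin 4 → ℂ) (i j : Fin 4) :
    inner ℂ (qFrame z i) (qFrame z j) = (if i = j then 1 else 0) - z i * conj (z j) / nrm z := by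
  have h : inner ℂ (affineLift 0 z) (e j.succ) = conj (z j) := by
    rw [← inner_conj_symm, inner_e_affineLift]; simp
  rw [qFrame, qFrame, inner_proj, h, inner_e_affineLift]
  simp [orthonormal_iff_ite.1 stdBasis.orthonormal]

/-- As the metric of `Q` is a rank one perturbation of the standard one, its `2 × 2` minors are
linear in the perturbation. -/
theorem inner_qFrame_wedge (z : Fin 4 → ℂ) (i j k l : Fin 4) :
    inner ℂ (exteriorPower.ιMulti ℂ 2 ![qFrame z i, qFrame z j])
      (exteriorPower.ιMulti ℂ 2 ![qFrame z k, qFrame z l]) =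
    ((if i = k then 1 else 0) * (if j = l then 1 else 0) -
      (if i = l then 1 else 0) * (if j = k then 1 else 0)) -
    ((if i = k then 1 else 0) * (z j * conj (z l)) + (if j = l then 1 else 0) * (z i * conj (z k)) -
      (if i = l then 1 else 0) * (z j * conj (z k)) -
      (if j = k then 1 else 0) * (z i * conj (z l))) / nrm z := by
  rw [inner_ιMulti, Matrix.det_fin_two]
  simp only [Matrix.of_apply, Matrix.cons_val_zero, Matrix.cons_val_one, inner_qFrame]
  ring

/-- The bivector with coordinates `c₁₂, c₁₃, c₁₄, c₂₃, c₂₄, c₃₄` with respect to the vectors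
`q₁, …, q₄`. -/
def bivec {W : Type*} [AddCommGroup W] [Module ℂ W] (q : Fin 4 → W) (c : Fin 6 → ℂ) : ⋀[ℂ]^2 W :=
  c 0 • exteriorPower.ιMulti ℂ 2 ![q 0, q 1] + c 1 • exteriorPower.ιMulti ℂ 2 ![q 0, q 2] +
  c 2 • exteriorPower.ιMulti ℂ 2 ![q 0, q 3] + c 3 • exteriorPower.ιMulti ℂ 2 ![q 1, q 2] +
  c 4 • exteriorPower.ιMulti ℂ 2 ![q 1, q 3] + c 5 • exteriorPower.ιMulti ℂ 2 ![q 2, q 3]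

/-- The coordinates of `x ∧ ξ ∈ ⋀³ℂ⁵` for `x = (1, z)` and `ξ` the bivector in `e₁, …, e₄` with
coordinates `c`. Up to the factor `|x|²`, this embeds `⋀²Q` isometrically and holomorphically into
a trivial bundle. -/
def wedgeCoord (z : Fin 4 → ℂ) (c : Fin 6 → ℂ) : Fin 10 → ℂ :=
  ![c 0, c 1, c 2, c 3, c 4, c 5, z 0 * c 3 - z 1 * c 1 + z 2 * c 0,
    z 0 * c 4 - z 1 * c 2 + z 3 * c 0, z 0 * c 5 - z 2 * c 2 + z 3 * c 1,
    z 1 * c 5 - z 2 * c 4 + z 3 * c 3]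

theorem inner_bivec (z : Fin 4 → ℂ) (c d : Fin 6 → ℂ) :
    inner ℂ (bivec (qFrame z) c) (bivec (qFrame z) d) =
      (nrm z)⁻¹ * ∑ T, conj (wedgeCoord z c T) * wedgeCoord z d T := by
  rw [eq_inv_mul_iff_mul_eq₀ (nrm_ne_zero z)]
  simp only [bivec, inner_add_left, inner_add_right, inner_smul_left, inner_smul_right,
    inner_qFrame_wedge]
  have hn := nrm_ne_zero z
  simp [Fin.sum_univ_succ, wedgeCoord]
  field_simp
  simp [nrm, Fin.sum_univ_succ]
  ring

/-- The element of `⋀²Q ⊕ ⋀²Q` with given coordinates. -/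
def lift (z : Fin 4 → ℂ) (c : (Fin 6 → ℂ) × (Fin 6 → ℂ)) : M (chart 0 z) :=
  WithLp.toLp 2 (bivec (qFrame z) c.1, bivec (qFrame z) c.2)

/-- The embedding of `⋀²Q ⊕ ⋀²Q` into a trivial bundle by `wedgeCoord`. -/
def emb (z : Fin 4 → ℂ) (c : (Fin 6 → ℂ) × (Fin 6 → ℂ)) : Fin 10 ⊕ Fin 10 → ℂ :=
  Sum.elim (wedgeCoord z c.1) (wedgeCoord z c.2)

theorem inner_lift (z : Fin 4 → ℂ) (c d : (Fin 6 → ℂ) × (Fin 6 → ℂ)) :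
    inner ℂ (lift z c) (lift z d) = (nrm z)⁻¹ * ∑ T, conj (emb z c T) * emb z d T := by
  rw [lift, lift, WithLp.prod_inner_apply]
  simp only [inner_bivec, emb, Fintype.sum_sum_type, Sum.elim_inl, Sum.elim_inr]
  ring

theorem inner_coordSection (z : Fin 4 → ℂ) :
    inner ℂ (coordSection 0 (chart 0 z)) (coordSection 0 (chart 0 z)) = (nrm z)⁻¹ := by
  have hx : affineLift 0 z ∈ (chart 0 z).submodule := by
    rw [submodule_chart]; exact Submodule.mem_span_singleton_self _
  have hn : conj (nrm z)⁻¹ = (nrm z)⁻¹ := by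
    rw [nrm_eq, ← Complex.ofReal_inv, Complex.conj_ofReal]
  let σ : StrongDual ℂ (chart 0 z).submodule :=
    LinearMap.toContinuousLinearMap (stdBasis.toBasis.coord 0 ∘ₗ (chart 0 z).submodule.subtype)
  have h : (InnerProductSpace.toDual ℂ (chart 0 z).submodule).symm σ =
      (nrm z)⁻¹ • ⟨affineLift 0 z, hx⟩ := by
    rw [LinearIsometryEquiv.symm_apply_eq]
    refine ContinuousLinearMap.ext fun ⟨y, hy⟩ => ?_
    have hy' := hy
    rw [submodule_chart, Submodule.mem_span_singleton] at hy'
    obtain ⟨t, rfl⟩ := hy'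
    rw [InnerProductSpace.toDual_apply_apply, inner_smul_left]
    change stdBasis.toBasis.coord 0 (t • affineLift 0 z) =
      conj (nrm z)⁻¹ * inner ℂ (affineLift 0 z) (t • affineLift 0 z)
    rw [inner_smul_right, inner_affineLift_self, hn, mul_left_comm,
      inv_mul_cancel₀ (nrm_ne_zero z), map_smul]
    simp [affineLift]
  change inner ℂ ((InnerProductSpace.toDual ℂ (chart 0 z).submodule).symm σ)
    ((InnerProductSpace.toDual ℂ (chart 0 z).submodule).symm σ) = _
  rw [h, inner_smul_left, inner_smul_right]
  change conj (nrm z)⁻¹ * ((nrm z)⁻¹ * inner ℂ (affineLift 0 z) (affineLift 0 z)) = _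
  rw [inner_affineLift_self, hn, inv_mul_cancel₀ (nrm_ne_zero z), mul_one]

/-! ### The monad in coordinates -/

/-- The coordinates of `⋀²π(a₊(eᵢ))`. -/
def aPlusCoord (i : Fin 5) (z : Fin 4 → ℂ) : Fin 6 → ℂ :=
  ![![0, 0, 0, 1, 0, 0], ![0, 0, 0, 0, 0, 1], ![0, 0, z 0, 0, z 1, z 2], ![z 1, z 2, z 3, 0, 0, 0],
    ![1, 0, 0, 0, 0, 0]] i

/-- The coordinates of `⋀²π(a₋(eᵢ))`. -/
def aMinusCoord (i : Fin 5) (z : Fin 4 → ℂ) : Fin 6 → ℂ :=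
  ![![0, 0, 1, 0, 0, 0], ![z 0, 0, 0, -z 2, -z 3, 0], ![0, -1, 0, 0, 0, 0], ![0, 0, 0, 0, -1, 0],
    ![0, -z 0, 0, -z 1, 0, z 3]] i

theorem ext2Proj_wedge (z : Fin 4 → ℂ) (i j : Fin 5) (c : Fin 6 → ℂ)
    (h : ExteriorAlgebra.ι ℂ (proj (chart 0 z) (e i)) *
        ExteriorAlgebra.ι ℂ (proj (chart 0 z) (e j)) =
      (bivec (qFrame z) c : ExteriorAlgebra ℂ (Q (chart 0 z)))) :
    ext2Proj (chart 0 z) (exteriorPower.ιMulti ℂ 2 ![e i, e j]) = bivec (qFrame z) c :=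
  Subtype.ext ((coe_ext2Proj _ _ _).trans h)

theorem coe_bivec {W : Type*} [AddCommGroup W] [Module ℂ W] (q : Fin 4 → W) (c : Fin 6 → ℂ) :
    (bivec q c : ExteriorAlgebra ℂ W) =
      c 0 • (ExteriorAlgebra.ι ℂ (q 0) * ExteriorAlgebra.ι ℂ (q 1)) +
      c 1 • (ExteriorAlgebra.ι ℂ (q 0) * ExteriorAlgebra.ι ℂ (q 2)) +
      c 2 • (ExteriorAlgebra.ι ℂ (q 0) * ExteriorAlgebra.ι ℂ (q 3)) +
      c 3 • (ExteriorAlgebra.ι ℂ (q 1) * ExteriorAlgebra.ι ℂ (q 2)) +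
      c 4 • (ExteriorAlgebra.ι ℂ (q 1) * ExteriorAlgebra.ι ℂ (q 3)) +
      c 5 • (ExteriorAlgebra.ι ℂ (q 2) * ExteriorAlgebra.ι ℂ (q 3)) := by
  simp [bivec, ExteriorAlgebra.ιMulti_apply]

theorem ι_mul_self {W : Type*} [AddCommGroup W] [Module ℂ W] (x : W) :
    ExteriorAlgebra.ι ℂ x * ExteriorAlgebra.ι ℂ x = 0 := by simp

theorem ι_mul_swap {W : Type*} [AddCommGroup W] [Module ℂ W] (x y : W) :
    ExteriorAlgebra.ι ℂ x * ExteriorAlgebra.ι ℂ y =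
      -(ExteriorAlgebra.ι ℂ y * ExteriorAlgebra.ι ℂ x) := by
  rw [eq_neg_iff_add_eq_zero]; exact ExteriorAlgebra.ι_add_mul_swap _ _

theorem ext2Proj_aPlus (z : Fin 4 → ℂ) (i : Fin 5) :
    ext2Proj (chart 0 z) (aPlus (e i)) = bivec (qFrame z) (aPlusCoord i z) := by
  have sw : ∀ i j, ExteriorAlgebra.ι ℂ (qFrame z i) * ExteriorAlgebra.ι ℂ (qFrame z j) =
      -(ExteriorAlgebra.ι ℂ (qFrame z j) * ExteriorAlgebra.ι ℂ (qFrame z i)) :=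
    fun i j => ι_mul_swap _ _
  rw [aPlus_e]
  apply ext2Proj_wedge
  rw [coe_bivec]
  have h1 : proj (chart 0 z) (e 1) = qFrame z 0 := rfl
  have h2 : proj (chart 0 z) (e 2) = qFrame z 1 := rfl
  have h3 : proj (chart 0 z) (e 3) = qFrame z 2 := rfl
  have h4 : proj (chart 0 z) (e 4) = qFrame z 3 := rfl
  fin_cases i <;>
  simp [aPlusCoord, proj_e_zero, h1, h2, h3, h4, Fin.sum_univ_four, mul_add, add_mul,
    sw 1 0, sw 2 0, sw 3 0, sw 3 1, sw 3 2] <;> abel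

theorem ext2Proj_aMinus (z : Fin 4 → ℂ) (i : Fin 5) :
    ext2Proj (chart 0 z) (aMinus (e i)) = bivec (qFrame z) (aMinusCoord i z) := by
  have sw : ∀ i j, ExteriorAlgebra.ι ℂ (qFrame z i) * ExteriorAlgebra.ι ℂ (qFrame z j) =
      -(ExteriorAlgebra.ι ℂ (qFrame z j) * ExteriorAlgebra.ι ℂ (qFrame z i)) :=
    fun i j => ι_mul_swap _ _
  rw [aMinus_e]
  apply ext2Proj_wedge
  rw [coe_bivec]
  have h1 : proj (chart 0 z) (e 1) = qFrame z 0 := rfl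
  have h2 : proj (chart 0 z) (e 2) = qFrame z 1 := rfl
  have h3 : proj (chart 0 z) (e 3) = qFrame z 2 := rfl
  have h4 : proj (chart 0 z) (e 4) = qFrame z 3 := rfl
  fin_cases i <;>
  simp [aMinusCoord, proj_e_zero, h1, h2, h3, h4, Fin.sum_univ_four, mul_add, add_mul,
    sw 1 0, sw 2 0, sw 3 1, sw 3 2] <;> abel

/-- The coordinates of the column `a(eᵢ)` of the monad map `a`. -/
def aCoord (i : Fin 5) (z : Fin 4 → ℂ) : (Fin 6 → ℂ) × (Fin 6 → ℂ) :=
  (aPlusCoord i z, aMinusCoord i z)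

theorem a_e (z : Fin 4 → ℂ) (i : Fin 5) : a (chart 0 z) (e i) = lift z (aCoord i z) := by
  rw [lift, aCoord, ← ext2Proj_aPlus, ← ext2Proj_aMinus]
  rfl

/-- The exterior product of bivectors in dimension four. -/
def wedgeForm (c d : Fin 6 → ℂ) : ℂ :=
  c 0 * d 5 - c 1 * d 4 + c 2 * d 3 + c 3 * d 2 - c 4 * d 1 + c 5 * d 0

theorem wedge22_bivec {W : Type*} [AddCommGroup W] [Module ℂ W] (q : Fin 4 → W) (c d : Fin 6 → ℂ) :
    wedge22 W (bivec q c) (bivec q d) = wedgeForm c d • exteriorPower.ιMulti ℂ 4 q := by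
  apply Subtype.ext
  change (bivec q c : ExteriorAlgebra ℂ W) * bivec q d =
    wedgeForm c d • (exteriorPower.ιMulti ℂ 4 q : ExteriorAlgebra ℂ W)
  have hω : (exteriorPower.ιMulti ℂ 4 q : ExteriorAlgebra ℂ W) = ExteriorAlgebra.ι ℂ (q 0) *
      (ExteriorAlgebra.ι ℂ (q 1) * (ExteriorAlgebra.ι ℂ (q 2) * ExteriorAlgebra.ι ℂ (q 3))) := by
    simp [ExteriorAlgebra.ιMulti_apply]
    rfl
  have sq : ∀ x : W, ExteriorAlgebra.ι ℂ x * ExteriorAlgebra.ι ℂ x = 0 := ι_mul_self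
  have sq' : ∀ (x : W) (w), ExteriorAlgebra.ι ℂ x * (ExteriorAlgebra.ι ℂ x * w) = 0 :=
    fun x w => by rw [← mul_assoc, sq, zero_mul]
  have sw : ∀ i j, ExteriorAlgebra.ι ℂ (q i) * ExteriorAlgebra.ι ℂ (q j) =
      -(ExteriorAlgebra.ι ℂ (q j) * ExteriorAlgebra.ι ℂ (q i)) := fun i j => ι_mul_swap _ _
  have sw' : ∀ (i j) (w), ExteriorAlgebra.ι ℂ (q i) * (ExteriorAlgebra.ι ℂ (q j) * w) =
      -(ExteriorAlgebra.ι ℂ (q j) * (ExteriorAlgebra.ι ℂ (q i) * w)) :=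
    fun i j w => by rw [← mul_assoc, sw, neg_mul, mul_assoc]
  rw [hω, coe_bivec, coe_bivec]
  simp only [mul_add, add_mul, smul_mul_smul_comm, mul_assoc, sq, sq', sw 2 1,
    sw 3 1, sw 3 2, sw' 1 0, sw' 2 0, sw' 3 0, sw' 2 1, sw' 3 1, sw' 3 2, mul_neg, neg_neg, mul_zero,
    smul_zero, neg_zero, smul_neg, wedgeForm]
  module

/-- The generator `e₁ ∧ e₂ ∧ e₃ ∧ e₄` of `⋀⁴Q` over the chart `U₀`. -/
def vol (z : Fin 4 → ℂ) : ⋀[ℂ]^4 (Q (chart 0 z)) := exteriorPower.ιMulti ℂ 4 (qFrame z)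

theorem b_lift (z : Fin 4 → ℂ) (c : (Fin 6 → ℂ) × (Fin 6 → ℂ)) (i : Fin 5) :
    b (chart 0 z) (lift z c) (e i) =
      (wedgeForm c.1 (aMinusCoord i z) - wedgeForm c.2 (aPlusCoord i z)) • vol z := by
  have h : b (chart 0 z) (lift z c) (e i) =
      -wedge22 _ (bivec (qFrame z) c.2) (ext2Proj (chart 0 z) (aPlus (e i))) +
        wedge22 _ (bivec (qFrame z) c.1) (ext2Proj (chart 0 z) (aMinus (e i))) := rfl
  rw [h, ext2Proj_aPlus, ext2Proj_aMinus, wedge22_bivec, wedge22_bivec, vol, sub_smul,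
    neg_add_eq_sub]

/-- The Gram determinant of `e₁, …, e₄` in `Q` is `1 / |x|²`. -/
theorem vol_ne_zero (z : Fin 4 → ℂ) : vol z ≠ 0 := by
  intro h
  have h1 : inner ℂ (vol z) (vol z) = (nrm z)⁻¹ := by
    rw [vol, inner_ιMulti]
    simp only [inner_qFrame]
    have hn := nrm_ne_zero z
    simp [Matrix.det_succ_row_zero, Fin.sum_univ_succ, Fin.succAbove]
    field_simp
    simp [nrm, Fin.sum_univ_succ]
    ring
  rw [h, inner_zero_left] at h1
  exact inv_ne_zero (nrm_ne_zero z) h1.symm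

/-- The coefficient of `b(ξ, η)(eᵢ)` with respect to `vol`. -/
def monadEq (z : Fin 4 → ℂ) (c : (Fin 6 → ℂ) × (Fin 6 → ℂ)) (i : Fin 5) : ℂ :=
  wedgeForm c.1 (aMinusCoord i z) - wedgeForm c.2 (aPlusCoord i z)

theorem lift_mem_ker_iff (z : Fin 4 → ℂ) (c : (Fin 6 → ℂ) × (Fin 6 → ℂ)) :
    lift z c ∈ LinearMap.ker (b (chart 0 z)) ↔ ∀ i, monadEq z c i = 0 := by
  rw [LinearMap.mem_ker]
  constructor
  · intro h i
    have hi := b_lift z c i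
    rw [h, LinearMap.zero_apply] at hi
    exact (smul_eq_zero.1 hi.symm).resolve_right (vol_ne_zero z)
  · intro h
    refine stdBasis.toBasis.ext fun i => ?_
    rw [OrthonormalBasis.coe_toBasis]
    refine (b_lift z c i).trans ?_
    rw [show wedgeForm c.1 (aMinusCoord i z) - wedgeForm c.2 (aPlusCoord i z) = 0 from h i,
      zero_smul]
    rfl

/-- `lift` as a linear map. -/
def liftₗ (z : Fin 4 → ℂ) : (Fin 6 → ℂ) × (Fin 6 → ℂ) →ₗ[ℂ] M (chart 0 z) where
  toFun := lift z
  map_add' c d := by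
    simp only [lift, bivec, ← WithLp.toLp_add, Prod.mk_add_mk, Prod.fst_add, Prod.snd_add,
      Pi.add_apply]
    congr 2 <;> module
  map_smul' t c := by
    simp only [lift, bivec, RingHom.id_apply, ← WithLp.toLp_smul, Prod.smul_mk, Prod.smul_fst,
      Prod.smul_snd, Pi.smul_apply, smul_eq_mul]
    congr 2 <;> module

theorem emb_zero_of_sum_eq_zero {z : Fin 4 → ℂ} {c : (Fin 6 → ℂ) × (Fin 6 → ℂ)}
    (h : ∑ T, conj (emb z c T) * emb z c T = 0) : c = 0 := by
  simp only [← Complex.normSq_eq_conj_mul_self] at h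
  norm_cast at h
  rw [Finset.sum_eq_zero_iff_of_nonneg (fun _ _ => Complex.normSq_nonneg _)] at h
  simp only [Finset.mem_univ, forall_const, Complex.normSq_eq_zero] at h
  refine Prod.ext (funext fun i => ?_) (funext fun i => ?_)
  · fin_cases i
    exacts [h (.inl 0), h (.inl 1), h (.inl 2), h (.inl 3), h (.inl 4), h (.inl 5)]
  · fin_cases i
    exacts [h (.inr 0), h (.inr 1), h (.inr 2), h (.inr 3), h (.inr 4), h (.inr 5)]

theorem liftₗ_injective (z : Fin 4 → ℂ) : Function.Injective (liftₗ z) := by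
  rw [injective_iff_map_eq_zero]
  intro c hc
  have h := inner_lift z c c
  rw [show lift z c = 0 from hc, inner_zero_left, eq_comm, mul_eq_zero] at h
  exact emb_zero_of_sum_eq_zero (h.resolve_left (inv_ne_zero (nrm_ne_zero z)))

theorem finrank_C5 : Module.finrank ℂ C5 = 5 := by
  rw [Module.finrank_eq_card_basis stdBasis.toBasis, Fintype.card_fin]

theorem finrank_Q (p : P4) : Module.finrank ℂ (Q p) = 4 := by
  have h := Submodule.finrank_quotient_add_finrank p.submodule
  rw [p.finrank_submodule, finrank_C5] at h
  exact Nat.succ.inj h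

theorem finrank_M (p : P4) : Module.finrank ℂ (M p) = 12 := by
  rw [(WithLp.linearEquiv 2 ℂ (⋀[ℂ]^2 (Q p) × ⋀[ℂ]^2 (Q p))).finrank_eq, Module.finrank_prod,
    exteriorPower.finrank_eq, finrank_Q]
  rfl

/-- By comparison of dimensions. -/
theorem liftₗ_surjective (z : Fin 4 → ℂ) : Function.Surjective (liftₗ z) := by
  refine (LinearMap.injective_iff_surjective_of_finrank_eq_finrank ?_).1 (liftₗ_injective z)
  rw [finrank_M]
  simp

/-- Where `z₁z₂z₃z₄ ≠ 1`, a solution of the equations of `ker b` is determined by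
`ξ₁₂, ξ₁₄, ξ₂₃, ξ₃₄, η₁₃, η₂₃, η₂₄`. -/
theorem finrank_KerB_le (z : Fin 4 → ℂ) (hz : 1 - z 0 * z 1 * z 2 * z 3 ≠ 0) :
    Module.finrank ℂ (KerB (chart 0 z)) ≤ 7 := by
  let K := (LinearMap.ker (b (chart 0 z))).comap (liftₗ z)
  have h1 : Module.finrank ℂ (KerB (chart 0 z)) ≤ Module.finrank ℂ K := by
    let f : K →ₗ[ℂ] LinearMap.ker (b (chart 0 z)) := (liftₗ z).restrict fun c hc => hc
    have hf : Function.Surjective f := by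
      rintro ⟨m, hm⟩
      obtain ⟨c, rfl⟩ := liftₗ_surjective z m
      exact ⟨⟨c, hm⟩, rfl⟩
    exact f.finrank_le_finrank_of_surjective hf
  let g : (Fin 6 → ℂ) × (Fin 6 → ℂ) →ₗ[ℂ] (Fin 7 → ℂ) :=
    { toFun := fun c => ![c.1 0, c.1 2, c.1 3, c.1 5, c.2 1, c.2 3, c.2 4]
      map_add' := fun c d => by ext i; fin_cases i <;> rfl
      map_smul' := fun t c => by ext i; fin_cases i <;> rfl }
  have h2 : Function.Injective (g ∘ₗ K.subtype) := by
    rw [injective_iff_map_eq_zero]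
    rintro ⟨⟨c, d⟩, hcd⟩ hg
    have hk := (lift_mem_ker_iff z (c, d)).1 hcd
    have g' : ∀ i, g (c, d) i = 0 := fun i => congrFun hg i
    have c0 : c 0 = 0 := g' 0
    have c2 : c 2 = 0 := g' 1
    have c3 : c 3 = 0 := g' 2
    have c5 : c 5 = 0 := g' 3
    have d1 : d 1 = 0 := g' 4
    have d3 : d 3 = 0 := g' 5
    have d4 : d 4 = 0 := g' 6
    have e0 := hk 0
    have e1 := hk 1
    have e2 := hk 2
    have e3 := hk 3
    have e4 := hk 4
    simp [monadEq, wedgeForm, aPlusCoord, aMinusCoord, c0, c2, c3, c5, d1, d3, d4]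
      at e0 e1 e2 e3 e4
    -- The remaining equations are cyclic: going around once multiplies `ξ₂₄` by `z₁z₂z₃z₄`.
    have hc4 : (1 - z 0 * z 1 * z 2 * z 3) * c 4 = 0 := by
      linear_combination e2 - z 2 * e1 + z 2 * z 3 * e3 - z 1 * z 2 * z 3 * e4
    have c4 : c 4 = 0 := (mul_eq_zero.1 hc4).resolve_left hz
    have d5 : d 5 = 0 := by linear_combination z 0 * c4 - e4
    have c1 : c 1 = 0 := by linear_combination e3 + z 1 * d5
    have d0 : d 0 = 0 := by linear_combination z 3 * c1 - e1
    refine Subtype.ext (Prod.ext (funext fun i => ?_) (funext fun i => ?_))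
    · fin_cases i <;> assumption
    · fin_cases i <;> assumption
  refine h1.trans ?_
  simpa using LinearMap.finrank_le_finrank_of_injective h2

/-! ### Sections of the Horrocks–Mumford bundle -/

/-- The element of `ker b` with given coordinates. -/
def kerLift (z : Fin 4 → ℂ) (c : (Fin 6 → ℂ) × (Fin 6 → ℂ)) (h : ∀ i, monadEq z c i = 0) :
    KerB (chart 0 z) :=
  ⟨lift z c, (lift_mem_ker_iff z c).2 h⟩

/-- The components of `emb` applied to a family of coordinate vectors. -/
def embF (c : (Fin 4 → ℂ) → (Fin 6 → ℂ) × (Fin 6 → ℂ)) (T : Fin 10 ⊕ Fin 10) (z : Fin 4 → ℂ) : ℂ :=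
  emb z (c z) T

/-- The columns of the monad map `a`, embedded into a trivial bundle. -/
def aCol (i : Fin 5) : Fin 10 ⊕ Fin 10 → (Fin 4 → ℂ) → ℂ := embF (aCoord i)

theorem a_apply (z : Fin 4 → ℂ) (y : Fin 5 → ℂ) :
    a (chart 0 z) (∑ i, y i • e i) = ∑ i, y i • lift z (aCoord i z) := by
  simp only [map_sum, map_smul, a_e]

theorem exists_eq_sum (v : C5) : ∃ y : Fin 5 → ℂ, v = ∑ i, y i • e i :=
  ⟨_, (stdBasis.sum_repr v).symm⟩

theorem a_mem_ker (p : P4) (v : C5) : a p v ∈ LinearMap.ker (b p) :=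
  LinearMap.congr_fun (b_comp_a p) v

theorem inner_aCoord_aCoord (z : Fin 4 → ℂ) (i j : Fin 5) :
    inner ℂ (lift z (aCoord i z)) (lift z (aCoord j z)) = (nrm z)⁻¹ * herm (aCol i) (aCol j) z :=
  inner_lift z _ _

theorem inner_aCoord_lift (z : Fin 4 → ℂ) (i : Fin 5)
    (d : (Fin 4 → ℂ) → (Fin 6 → ℂ) × (Fin 6 → ℂ)) :
    inner ℂ (lift z (aCoord i z)) (lift z (d z)) = (nrm z)⁻¹ * herm (aCol i) (embF d) z :=
  inner_lift z _ _

theorem inner_lift_aCoord (z : Fin 4 → ℂ) (i : Fin 5)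
    (d : (Fin 4 → ℂ) → (Fin 6 → ℂ) × (Fin 6 → ℂ)) :
    inner ℂ (lift z (d z)) (lift z (aCoord i z)) = (nrm z)⁻¹ * herm (embF d) (aCol i) z :=
  inner_lift z _ _

/-- The map `a(p)` as a map to `ker b(p)`. -/
def aKer (p : P4) (v : C5) : KerB p := ⟨a p v, a_mem_ker p v⟩

theorem inner_KerB {p : P4} (k l : KerB p) : inner ℂ k l = inner ℂ (kerIncl p k) (kerIncl p l) :=
  rfl

/-- The metric of `ker b / im a` in coordinates. -/
theorem inner_kerProj (c d : (Fin 4 → ℂ) → (Fin 6 → ℂ) × (Fin 6 → ℂ)) (z : Fin 4 → ℂ)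
    (hc : ∀ i, monadEq z (c z) i = 0) (hd : ∀ i, monadEq z (d z) i = 0)
    (hdet : (gramMat aCol z).det ≠ 0) :
    inner ℂ (kerProj _ (kerLift z (c z) hc)) (kerProj _ (kerLift z (d z) hd)) =
      (nrm z)⁻¹ * (herm (embF c) (embF d) z -
        ∑ i, conj (herm (aCol i) (embF c) z) * projCoeff aCol (embF d) z i) := by
  have hincl : kerIncl _ (kerLift z (d z) hd -
      aKer (chart 0 z) (∑ i, projCoeff aCol (embF d) z i • e i)) =
      lift z (d z) - ∑ i, projCoeff aCol (embF d) z i • lift z (aCoord i z) := by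
    rw [← a_apply, map_sub]; rfl
  have horth : ∀ i, inner ℂ (lift z (aCoord i z))
      (lift z (d z) - ∑ i, projCoeff aCol (embF d) z i • lift z (aCoord i z)) = 0 := by
    intro i
    rw [inner_sub_right, inner_sum]
    simp only [inner_smul_right, inner_aCoord_aCoord]
    rw [inner_aCoord_lift, ← gramMat_mulVec_projCoeff hdet, Finset.mul_sum, sub_eq_zero]
    exact Finset.sum_congr rfl fun j _ => by ring
  have hk : kerLift z (d z) hd -
      aKer (chart 0 z) (∑ i, projCoeff aCol (embF d) z i • e i) ∈ (imA (chart 0 z))ᗮ := by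
    rintro u ⟨v, hv⟩
    obtain ⟨t, rfl⟩ := exists_eq_sum v
    rw [inner_KerB, hincl, ← hv, a_apply, sum_inner]
    exact Finset.sum_eq_zero fun i _ => by rw [inner_smul_left, horth, mul_zero]
  refine (inner_mkQ (imA (chart 0 z)) ⟨_, rfl⟩ hk).trans ?_
  rw [inner_KerB, hincl, inner_sub_right, inner_sum, mul_sub, Finset.mul_sum]
  congr 1
  · exact inner_lift z _ _
  · refine Finset.sum_congr rfl fun j _ => ?_
    rw [inner_smul_right, herm_conj_symm, mul_comm (herm _ _ _), mul_left_comm,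
      ← inner_lift_aCoord]
    rfl

instance (p : P4) : FiniteDimensional ℂ (EMinus2 p) :=
  inferInstanceAs (FiniteDimensional ℂ (KerB p ⧸ imA p))

instance (p : P4) : FiniteDimensional ℂ (O1 p) :=
  inferInstanceAs (FiniteDimensional ℂ (StrongDual ℂ p.submodule))

theorem finrank_O1 (p : P4) : Module.finrank ℂ (O1 p) = 1 := by
  have h := (LinearMap.toContinuousLinearMap (𝕜 := ℂ) (E := p.submodule) (F' := ℂ)).finrank_eq
  rw [Module.finrank_linearMap, p.finrank_submodule, Module.finrank_self] at h
  exact h.symm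

theorem a_injective (z : Fin 4 → ℂ) (hdet : (gramMat aCol z).det ≠ 0) :
    Function.Injective (a (chart 0 z)) := by
  rw [injective_iff_map_eq_zero]
  intro v hv
  obtain ⟨y, rfl⟩ := exists_eq_sum v
  rw [a_apply] at hv
  have h : (gramMat aCol z).mulVec y = 0 := by
    ext i
    have hi : inner ℂ (lift z (aCoord i z)) (∑ j, y j • lift z (aCoord j z)) = 0 := by
      rw [hv, inner_zero_right]
    rw [inner_sum] at hi
    simp only [inner_smul_right, inner_aCoord_aCoord, mul_left_comm _ (nrm z)⁻¹,
      ← Finset.mul_sum] at hi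
    have := (mul_eq_zero.1 hi).resolve_left (inv_ne_zero (nrm_ne_zero z))
    simpa [Matrix.mulVec, dotProduct, gramMat, mul_comm] using this
  rw [Matrix.eq_zero_of_mulVec_eq_zero hdet h]
  simp

/-- The rank of `ker b / im a` is at most `7 - 5`. -/
theorem finrank_EMinus2_le (z : Fin 4 → ℂ) (hz : 1 - z 0 * z 1 * z 2 * z 3 ≠ 0)
    (hdet : (gramMat aCol z).det ≠ 0) : Module.finrank ℂ (EMinus2 (chart 0 z)) ≤ 2 := by
  have h1 := (imA (chart 0 z)).finrank_quotient_add_finrank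
  have h2 := finrank_KerB_le z hz
  let f : C5 →ₗ[ℂ] imA (chart 0 z) :=
    ((a (chart 0 z)).codRestrict (LinearMap.ker (b (chart 0 z))) (a_mem_ker _)).codRestrict
      (imA (chart 0 z)) fun v => ⟨v, rfl⟩
  have hf : Function.Injective f := fun u v huv =>
    a_injective z hdet (congrArg (fun w : imA (chart 0 z) => kerIncl _ w.1) huv)
  have h3 := LinearMap.finrank_le_finrank_of_injective hf
  rw [finrank_C5] at h3
  have h4 : Module.finrank ℂ (EMinus2 (chart 0 z)) =
    Module.finrank ℂ (KerB (chart 0 z) ⧸ imA (chart 0 z)) := rfl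
  omega

/-- The section of `E` over `U₀` given by coordinates of a section of `ker b`. -/
def eSection (c : (Fin 4 → ℂ) → (Fin 6 → ℂ) × (Fin 6 → ℂ)) (hc : ∀ z i, monadEq z (c z) i = 0)
    (z : Fin 4 → ℂ) : E (chart 0 z) :=
  kerProj (chart 0 z) (kerLift z (c z) (hc z)) ⊗ₜ[ℂ]
    (coordSection 0 (chart 0 z) ⊗ₜ[ℂ] coordSection 0 (chart 0 z))

theorem ext2Proj_bivec (z : Fin 4 → ℂ) (c : Fin 6 → ℂ) :
    ext2Proj (chart 0 z) (bivec (fun k => e k.succ) c) = bivec (qFrame z) c := by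
  have h : ∀ i j : Fin 4, ext2Proj (chart 0 z) (exteriorPower.ιMulti ℂ 2 ![e i.succ, e j.succ]) =
      exteriorPower.ιMulti ℂ 2 ![qFrame z i, qFrame z j] := by
    intro i j
    rw [ext2Proj, exteriorPower.map_apply_ιMulti]
    congr 1
    ext k
    fin_cases k <;> rfl
  simp only [bivec, map_add, map_smul, h]

theorem differentiable_bivec (q : Fin 4 → C5) {c : (Fin 4 → ℂ) → Fin 6 → ℂ}
    (hc : ∀ i, Differentiable ℂ fun z => c z i) :
    Differentiable ℂ fun z => bivec q (c z) := by
  unfold bivec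
  have := fun i (v : ⋀[ℂ]^2 C5) => (hc i).smul_const v
  exact (((((this 0 _).add (this 1 _)).add (this 2 _)).add (this 3 _)).add (this 4 _)).add
    (this 5 _)

theorem isHolomorphicSection_eSection {c : (Fin 4 → ℂ) → (Fin 6 → ℂ) × (Fin 6 → ℂ)}
    (hc : ∀ z i, monadEq z (c z) i = 0) (h1 : ∀ i, Differentiable ℂ fun z => (c z).1 i)
    (h2 : ∀ i, Differentiable ℂ fun z => (c z).2 i) {V : Set (Fin 4 → ℂ)} (hV : IsOpen V) :
    IsHolomorphicSection 0 V (eSection c hc) := by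
  intro z₀ hz₀
  refine ⟨V, subset_rfl, hV, hz₀, fun z => bivec (fun k => e k.succ) (c z).1,
    fun z => bivec (fun k => e k.succ) (c z).2, (differentiable_bivec _ h1).differentiableOn,
    (differentiable_bivec _ h2).differentiableOn, fun z _ => ⟨kerLift z (c z) (hc z), ?_, rfl⟩⟩
  rw [ext2Proj_bivec, ext2Proj_bivec]
  rfl

theorem linearIndependent_of_det_inner_ne_zero {F : Type*} [NormedAddCommGroup F]
    [InnerProductSpace ℂ F] {r : ℕ} (v : Fin r → F)
    (h : (Matrix.of fun k l => inner ℂ (v l) (v k)).det ≠ 0) : LinearIndependent ℂ v := by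
  rw [Fintype.linearIndependent_iff]
  intro g hg
  have h0 : Matrix.vecMul g (Matrix.of fun k l => inner ℂ (v l) (v k)) = 0 := by
    ext l
    have hl : inner ℂ (v l) (∑ k, g k • v k) = 0 := by rw [hg, inner_zero_right]
    rw [inner_sum] at hl
    simp only [inner_smul_right] at hl
    exact hl
  exact congrFun (Matrix.eq_zero_of_vecMul_eq_zero h h0)

/-- That a family is a basis, in terms of the module structure of an inner product space. -/
def IsFrame {F : Type*} [NormedAddCommGroup F] [InnerProductSpace ℂ F] {r : ℕ} (v : Fin r → F) :
    Prop :=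
  LinearIndependent ℂ v ∧ Submodule.span ℂ (Set.range v) = ⊤

theorem isFrame_tensorProduct {X Y : Type*} [NormedAddCommGroup X] [InnerProductSpace ℂ X]
    [NormedAddCommGroup Y] [InnerProductSpace ℂ Y] [FiniteDimensional ℂ X] [FiniteDimensional ℂ Y]
    {r : ℕ} (hX : Module.finrank ℂ X ≤ r) (hY : Module.finrank ℂ Y = 1)
    (v : Fin r → X ⊗[ℂ] (Y ⊗[ℂ] Y))
    (h : (Matrix.of fun k l => inner ℂ (v l) (v k)).det ≠ 0) : IsFrame v := by
  have hli := linearIndependent_of_det_inner_ne_zero v h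
  refine ⟨hli, hli.span_eq_top_of_card_eq_finrank' ?_⟩
  have hF : Module.finrank ℂ (X ⊗[ℂ] (Y ⊗[ℂ] Y)) ≤ r := by
    rwa [Module.finrank_tensorProduct, Module.finrank_tensorProduct, hY, mul_one, mul_one]
  have : FiniteDimensional ℂ (X ⊗[ℂ] (Y ⊗[ℂ] Y)) := inferInstance
  refine le_antisymm hli.fintype_card_le_finrank ?_
  rwa [Fintype.card_fin]

variable {S : Fin 2 → (Fin 4 → ℂ) → (Fin 6 → ℂ) × (Fin 6 → ℂ)}

/-- The natural metric of `E` is conformal to the quotient metric `schurMat`: one factor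
`|x|⁻²` comes from the embedding `emb`, two from `𝒪(2)`. -/
theorem inner_eSection (hS : ∀ k z i, monadEq z (S k z) i = 0) (z : Fin 4 → ℂ)
    (hdet : (gramMat aCol z).det ≠ 0) :
    (Matrix.of fun k l => inner ℂ (eSection (S l) (hS l) z) (eSection (S k) (hS k) z)) =
      ((nrm z)⁻¹ ^ 3) • schurMat aCol (fun k => embF (S k)) z := by
  ext k l
  rw [Matrix.of_apply, eSection, eSection, TensorProduct.inner_tmul, TensorProduct.inner_tmul,
    inner_kerProj _ _ _ _ _ hdet, inner_coordSection, Matrix.smul_apply, schurMat, Matrix.of_apply,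
    smul_eq_mul]
  ring

/-- Two sections with invertible Gram matrix form a frame, since the fibre has dimension at most
two. -/
theorem isFrame_eSection (hS : ∀ k z i, monadEq z (S k z) i = 0) (z : Fin 4 → ℂ)
    (hz : 1 - z 0 * z 1 * z 2 * z 3 ≠ 0) (hdet : (gramMat aCol z).det ≠ 0)
    (hH : (schurMat aCol (fun k => embF (S k)) z).det ≠ 0) :
    IsFrame (fun k => eSection (S k) (hS k) z) := by
  refine isFrame_tensorProduct (finrank_EMinus2_le z hz hdet) (finrank_O1 _) _ ?_
  rw [inner_eSection hS z hdet, Matrix.det_smul]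
  exact mul_ne_zero (pow_ne_zero _ (pow_ne_zero _ (inv_ne_zero (nrm_ne_zero z)))) hH

/-! ### A normal frame at the point `(1, 2, 0, 0, 0)` -/

/-- `f` is holomorphic, with value `A` and derivatives `B` at `p`. -/
def OneJet (f : (Fin 4 → ℂ) → ℂ) (p : Fin 4 → ℂ) (A : ℂ) (B : Fin 4 → ℂ) : Prop :=
  ContDiff ℂ 2 f ∧ f p = A ∧ ∀ α, dz α f p = B α

namespace OneJet

variable {f g : (Fin 4 → ℂ) → ℂ} {p : Fin 4 → ℂ} {A A' : ℂ} {B B' : Fin 4 → ℂ}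

theorem diffR (h : OneJet f p A B) : DifferentiableAt ℝ f p :=
  (h.1.restrict_scalars ℝ).differentiable (by simp) p

theorem const (c : ℂ) : OneJet (fun _ => c) p c 0 :=
  ⟨contDiff_const, rfl, fun α => dz_const α c⟩

theorem coord (k : Fin 4) : OneJet (fun z => z k) p (p k) (Pi.single k 1) := by
  refine ⟨(ContinuousLinearMap.proj k : (Fin 4 → ℂ) →L[ℂ] ℂ).contDiff, rfl, fun α => ?_⟩
  rw [dz_eq_fderiv α (by fun_prop)]
  have h : HasFDerivAt (fun z : Fin 4 → ℂ => z k)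
      (ContinuousLinearMap.proj k : (Fin 4 → ℂ) →L[ℂ] ℂ) p := hasFDerivAt_apply k p
  rw [h.fderiv]
  simp [Pi.single_apply, eq_comm]

theorem add (hf : OneJet f p A B) (hg : OneJet g p A' B') :
    OneJet (fun z => f z + g z) p (A + A') (B + B') :=
  ⟨hf.1.add hg.1, by simp only [hf.2.1, hg.2.1], fun α => by
    rw [dz_add α hf.diffR hg.diffR, hf.2.2, hg.2.2, Pi.add_apply]⟩

theorem mul (hf : OneJet f p A B) (hg : OneJet g p A' B') :
    OneJet (fun z => f z * g z) p (A * A') (A • B' + A' • B) :=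
  ⟨hf.1.mul hg.1, by simp only [hf.2.1, hg.2.1], fun α => by
    rw [dz_mul α hf.diffR hg.diffR, hf.2.2, hg.2.2, hf.2.1, hg.2.1]
    simp [mul_comm]⟩

theorem neg (hf : OneJet f p A B) : OneJet (fun z => -f z) p (-A) (-B) := by
  have h := (const (p := p) (-1)).mul hf
  simpa using h

theorem sub (hf : OneJet f p A B) (hg : OneJet g p A' B') :
    OneJet (fun z => f z - g z) p (A - A') (B - B') := by
  simpa [sub_eq_add_neg] using hf.add hg.neg

theorem congr (hf : OneJet f p A B) (hA : A = A') (hB : B = B') : OneJet f p A' B' := by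
  subst hA hB; exact hf

end OneJet

/-- The derivatives of `emb` at `p`, in terms of the value `A` and the derivatives `B` of its
argument. -/
theorem OneJet.embF {c : (Fin 4 → ℂ) → (Fin 6 → ℂ) × (Fin 6 → ℂ)} {p : Fin 4 → ℂ}
    {A : (Fin 6 → ℂ) × (Fin 6 → ℂ)} {B : Fin 4 → (Fin 6 → ℂ) × (Fin 6 → ℂ)}
    (h1 : ∀ i, OneJet (fun z => (c z).1 i) p (A.1 i) fun α => (B α).1 i)
    (h2 : ∀ i, OneJet (fun z => (c z).2 i) p (A.2 i) fun α => (B α).2 i) (T : Fin 10 ⊕ Fin 10) :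
    OneJet (embF c T) p (emb p A T)
      fun α => emb p (B α) T + emb (Pi.single α 1) A T - emb 0 A T := by
  have key : ∀ (d : (Fin 4 → ℂ) → Fin 6 → ℂ) (a : Fin 6 → ℂ) (b : Fin 4 → Fin 6 → ℂ),
      (∀ i, OneJet (fun z => d z i) p (a i) fun α => b α i) → ∀ T,
      OneJet (fun z => wedgeCoord z (d z) T) p (wedgeCoord p a T)
        fun α => wedgeCoord p (b α) T + wedgeCoord (Pi.single α 1) a T - wedgeCoord 0 a T := by
    intro d a b h T
    have h3 : ∀ i j k l m n, OneJet (fun z => z i * d z j - z k * d z l + z m * d z n) p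
        (p i * a j - p k * a l + p m * a n)
        fun α => (p i * b α j - p k * b α l + p m * b α n) +
          ((Pi.single α 1 : Fin 4 → ℂ) i * a j - (Pi.single α 1 : Fin 4 → ℂ) k * a l +
            (Pi.single α 1 : Fin 4 → ℂ) m * a n) -
          ((0 : Fin 4 → ℂ) i * a j - (0 : Fin 4 → ℂ) k * a l + (0 : Fin 4 → ℂ) m * a n) := by
      intro i j k l m n
      refine ((((coord i).mul (h j)).sub ((coord k).mul (h l))).add
        ((coord m).mul (h n))).congr rfl (funext fun α => ?_)
      have hs : ∀ i j : Fin 4, (Pi.single i 1 : Fin 4 → ℂ) j = (Pi.single j 1 : Fin 4 → ℂ) i :=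
        fun i j => by simp [Pi.single_apply, eq_comm]
      simp only [Pi.add_apply, Pi.sub_apply, Pi.smul_apply, smul_eq_mul, Pi.zero_apply, hs _ α]
      ring
    have h0 : ∀ i, OneJet (fun z => d z i) p (a i) fun α => b α i + a i - a i := fun i => by
      simpa using h i
    fin_cases T
    exacts [h0 0, h0 1, h0 2, h0 3, h0 4, h0 5, h3 _ _ _ _ _ _, h3 _ _ _ _ _ _, h3 _ _ _ _ _ _,
      h3 _ _ _ _ _ _]
  rcases T with T | T
  · exact key (fun z => (c z).1) A.1 (fun α => (B α).1) h1 T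
  · exact key (fun z => (c z).2) A.2 (fun α => (B α).2) h2 T

/-- The solution of the equations of `ker b` with `ξ₁₄ = 1 - z₁z₂z₃z₄` for which the other
coordinates that determine a solution (see `finrank_KerB_le`) are zero. -/
def sigU (z : Fin 4 → ℂ) : (Fin 6 → ℂ) × (Fin 6 → ℂ) :=
  (![0, -(z 1 * z 1) - z 0 * z 1 * z 2 * z 2, 1 - z 0 * z 1 * z 2 * z 3, 0,
      -(z 2 * z 2) - z 1 * z 1 * z 2 * z 3, 0],
    ![-z 2 - z 1 * z 1 * z 3, 0, 0, 0, 0, -z 1 - z 0 * z 2 * z 2])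

/-- The solution of the equations of `ker b` with `η₂₃ = 1 - z₁z₂z₃z₄` for which the other
coordinates that determine a solution (see `finrank_KerB_le`) are zero. -/
def sigV (z : Fin 4 → ℂ) : (Fin 6 → ℂ) × (Fin 6 → ℂ) :=
  (![0, z 0 * z 0 * z 1 + z 3, 0, 0, z 0 + z 2 * z 3 * z 3, 0],
    ![z 3 * (z 0 * z 0 * z 1 + z 3), 0, 0, 1 - z 0 * z 1 * z 2 * z 3, 0,
      z 0 * (z 0 + z 2 * z 3 * z 3)])

/-- Coordinates of a frame of `E` near `(1, 2, 0, 0, 0)`. The coefficients are affine linear in `z`.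
Their values at the point make the frame orthogonal to `im a` and to itself there, and their
derivatives are the solution of the linear system which says that the derivatives of the frame are
orthogonal to `im a` and to the frame. -/
def frameCoord : Fin 2 → (Fin 4 → ℂ) → (Fin 6 → ℂ) × (Fin 6 → ℂ) :=
  ![fun z => (18 * z 0 - 15) • sigU z + (548 / 105 * z 1 - 16 / 15 * z 3) • sigV z +
      (-4 / 3 * z 2) • aCoord 0 z + (94 / 9 * z 2) • aCoord 1 z + (-2 - 4 * z 0) • aCoord 2 z +
      (4 : ℂ) • aCoord 4 z,
    fun z => (1 - 44 / 35 * (z 0 - 2)) • sigV z]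

theorem monadEq_frameCoord (k : Fin 2) (z : Fin 4 → ℂ) (i : Fin 5) :
    monadEq z (frameCoord k z) i = 0 := by
  fin_cases k <;> fin_cases i <;>
  simp [monadEq, frameCoord, sigU, sigV, wedgeForm, aCoord, aPlusCoord, aMinusCoord] <;> ring

/-- The point `(1, 2, 0, 0, 0)` in affine coordinates. At the coordinate point `z = 0` the mean
curvature is scalar, so a point of this kind is needed. -/
def pt : Fin 4 → ℂ := ![2, 0, 0, 0]

/-- The values of `frameCoord` at `pt`. -/
def frameVal : Fin 2 → (Fin 6 → ℂ) × (Fin 6 → ℂ) :=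
  ![(![4, 0, 1, 0, 0, 0], ![0, 2, 0, 0, 0, 0]), (![0, 0, 0, 0, 2, 0], ![0, 0, 0, 1, 0, 4])]

/-- The derivatives of `frameCoord` at `pt`. -/
def frameDer : Fin 2 → Fin 4 → (Fin 6 → ℂ) × (Fin 6 → ℂ) :=
  ![![(![0, 0, 0, 0, 0, 0], ![0, 0, 0, 0, 0, 0]),
      (![0, 0, 0, 0, 46 / 105, 0], ![0, 0, 0, 128 / 105, 0, -13 / 105]),
      (![0, 0, 0, -4 / 3, 0, 4 / 9], ![-1 / 9, 0, -4 / 3, 0, 0, 0]),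
      (![0, 0, 0, 0, -32 / 15, 0], ![0, 0, 0, -16 / 15, 0, -4 / 15])],
    ![(![0, 0, 0, 0, -53 / 35, 0], ![0, 0, 0, -44 / 35, 0, -36 / 35]),
      (![0, 4, 0, 0, 0, 0], ![0, 0, 0, 0, 0, 0]),
      (![0, 0, 0, 0, 0, 0], ![0, 0, 0, 0, 0, 0]),
      (![0, 1, 0, 0, 0, 0], ![0, 0, 0, 0, 0, 0])]]

theorem oneJet_frameCoord_fst (k : Fin 2) (i : Fin 6) :
    OneJet (fun z => (frameCoord k z).1 i) pt ((frameVal k).1 i) fun α => (frameDer k α).1 i := by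
  fin_cases k <;> fin_cases i <;>
  simp [frameCoord, sigU, sigV, aCoord, aPlusCoord, aMinusCoord] <;>
  -- The jet is built along the structure of the polynomial, then compared with the table.
  refine OneJet.congr (by
    repeat' first
      | exact OneJet.const _
      | exact OneJet.coord _
      | apply OneJet.add
      | apply OneJet.sub
      | apply OneJet.mul
      | apply OneJet.neg) ?_ (funext fun α => ?_)
  all_goals first
    | (fin_cases α <;> simp [pt, frameDer] <;> norm_num)
    | (simp [pt, frameVal] <;> norm_num)

theorem oneJet_frameCoord_snd (k : Fin 2) (i : Fin 6) :
    OneJet (fun z => (frameCoord k z).2 i) pt ((frameVal k).2 i) fun α => (frameDer k α).2 i := by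
  fin_cases k <;> fin_cases i <;>
  simp [frameCoord, sigU, sigV, aCoord, aPlusCoord, aMinusCoord] <;>
  refine OneJet.congr (by
    repeat' first
      | exact OneJet.const _
      | exact OneJet.coord _
      | apply OneJet.add
      | apply OneJet.sub
      | apply OneJet.mul
      | apply OneJet.neg) ?_ (funext fun α => ?_)
  all_goals first
    | (fin_cases α <;> simp [pt, frameDer] <;> norm_num)
    | (simp [pt, frameVal] <;> norm_num)

theorem oneJet_aCoord_fst (j : Fin 5) (i : Fin 6) :
    OneJet (fun z => (aCoord j z).1 i) pt ((aCoord j pt).1 i) fun α =>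
      (aCoord j (Pi.single α 1) - aCoord j 0).1 i := by
  fin_cases j <;> fin_cases i <;>
  simp [aCoord, aPlusCoord, aMinusCoord] <;>
  refine OneJet.congr (by
    repeat' first
      | exact OneJet.const _
      | exact OneJet.coord _) ?_ (funext fun α => ?_)
  all_goals first
    | rfl
    | (fin_cases α <;> simp)

theorem oneJet_aCoord_snd (j : Fin 5) (i : Fin 6) :
    OneJet (fun z => (aCoord j z).2 i) pt ((aCoord j pt).2 i) fun α =>
      (aCoord j (Pi.single α 1) - aCoord j 0).2 i := by
  fin_cases j <;> fin_cases i <;>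
  simp [aCoord, aPlusCoord, aMinusCoord] <;>
  refine OneJet.congr (by
    repeat' first
      | exact OneJet.const _
      | exact OneJet.coord _
      | apply OneJet.neg) ?_ (funext fun α => ?_)
  all_goals first
    | rfl
    | (fin_cases α <;> simp)

theorem dz_aCol (i : Fin 5) (α : Fin 4) (T : Fin 10 ⊕ Fin 10) :
    dz α (aCol i T) pt = emb pt (aCoord i (Pi.single α 1) - aCoord i 0) T +
      emb (Pi.single α 1) (aCoord i pt) T - emb 0 (aCoord i pt) T :=
  (OneJet.embF (B := fun α => aCoord i (Pi.single α 1) - aCoord i 0) (oneJet_aCoord_fst i)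
    (oneJet_aCoord_snd i) T).2.2 α

theorem contDiff_aCol (i : Fin 5) (T : Fin 10 ⊕ Fin 10) : ContDiff ℂ 2 (aCol i T) :=
  (OneJet.embF (B := fun α => aCoord i (Pi.single α 1) - aCoord i 0) (oneJet_aCoord_fst i)
    (oneJet_aCoord_snd i) T).1

theorem oneJet_frame (k : Fin 2) (T : Fin 10 ⊕ Fin 10) :
    OneJet (embF (frameCoord k) T) pt (emb pt (frameVal k) T) fun α => emb pt (frameDer k α) T +
      emb (Pi.single α 1) (frameVal k) T - emb 0 (frameVal k) T :=
  OneJet.embF (oneJet_frameCoord_fst k) (oneJet_frameCoord_snd k) T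

theorem herm_aCol_aCol (i j : Fin 5) :
    herm (aCol i) (aCol j) pt = !![6, 0, 0, 0, 0; 0, 9, 0, 0, 0; 0, 0, 5, 0, 2; 0, 0, 0, 5, 0;
      0, 0, 2, 0, 5] i j := by
  fin_cases i <;> fin_cases j <;>
  simp [herm, aCol, embF, emb, wedgeCoord, aCoord, aPlusCoord, aMinusCoord, pt,
    Fin.sum_univ_succ, Complex.conj_ofNat] <;> norm_num

theorem det_gramMat_ne_zero : (gramMat aCol pt).det ≠ 0 := by
  have h : gramMat aCol pt = !![6, 0, 0, 0, 0; 0, 9, 0, 0, 0; 0, 0, 5, 0, 2; 0, 0, 0, 5, 0;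
      0, 0, 2, 0, 5] := by
    ext i j; exact herm_aCol_aCol i j
  rw [h]
  simp [Matrix.det_succ_row_zero, Fin.sum_univ_succ, Fin.succAbove]
  norm_num

theorem herm_aCol_frame (i : Fin 5) (k : Fin 2) : herm (aCol i) (embF (frameCoord k)) pt = 0 := by
  simp only [herm, (oneJet_frame k _).2.1]
  fin_cases i <;> fin_cases k <;>
  simp [aCol, embF, emb, wedgeCoord, aCoord, aPlusCoord, aMinusCoord, pt, frameVal,
    Fin.sum_univ_succ, Complex.conj_ofNat] <;> norm_num

set_option maxHeartbeats 2000000 in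
theorem herm_aCol_dz_frame (i : Fin 5) (k : Fin 2) (α : Fin 4) :
    ∑ T, conj (aCol i T pt) * dz α (embF (frameCoord k) T) pt = 0 := by
  simp only [(oneJet_frame k _).2.2]
  fin_cases i <;> fin_cases k <;> fin_cases α <;>
  simp [aCol, embF, emb, wedgeCoord, aCoord, aPlusCoord, aMinusCoord, pt, frameVal, frameDer,
    Fin.sum_univ_succ, Complex.conj_ofNat] <;> norm_num

theorem herm_frame_dz_frame (k l : Fin 2) (α : Fin 4) :
    ∑ T, conj (embF (frameCoord l) T pt) * dz α (embF (frameCoord k) T) pt = 0 := by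
  simp only [(oneJet_frame _ _).2.2, (oneJet_frame _ _).2.1]
  fin_cases l <;> fin_cases k <;> fin_cases α <;>
  simp [emb, wedgeCoord, pt, frameVal, frameDer, Fin.sum_univ_succ, Complex.conj_ofNat] <;> norm_num

theorem herm_frame_frame (k l : Fin 2) :
    herm (embF (frameCoord l)) (embF (frameCoord k)) pt = !![21, 0; 0, 105] k l := by
  simp only [herm, (oneJet_frame _ _).2.1]
  fin_cases l <;> fin_cases k <;>
  simp [emb, wedgeCoord, pt, frameVal, Fin.sum_univ_succ, Complex.conj_ofNat] <;> norm_num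

/-- The products `⟨∂_α A_i, φ_k⟩` at `pt`. -/
def rhoVal : Fin 2 → Fin 4 → Fin 5 → ℂ :=
  ![![![0, 0, 1, 0, -2], ![0, 0, 0, 4, 0], ![0, 0, 0, 0, 0], ![0, 0, 0, 1, 0]],
    ![![0, 0, 0, 0, 0], ![0, 0, 4, 0, -1], ![-8, -1, 0, 0, 0], ![0, 0, -8, 0, 8]]]

/-- The solutions `c` of `A* A c = rhoVal` at `pt`. -/
def rhoSol : Fin 2 → Fin 4 → Fin 5 → ℂ :=
  ![![![0, 0, 3 / 7, 0, -4 / 7], ![0, 0, 0, 4 / 5, 0], ![0, 0, 0, 0, 0], ![0, 0, 0, 1 / 5, 0]],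
    ![![0, 0, 0, 0, 0], ![0, 0, 22 / 21, 0, -13 / 21], ![-4 / 3, -1 / 9, 0, 0, 0],
      ![0, 0, -8 / 3, 0, 8 / 3]]]

set_option maxHeartbeats 2000000 in
theorem herm_dz_aCol_frame (k : Fin 2) (α : Fin 4) (i : Fin 5) :
    ∑ T, conj (dz α (aCol i T) pt) * embF (frameCoord k) T pt = rhoVal k α i := by
  simp only [dz_aCol, (oneJet_frame _ _).2.1]
  fin_cases i <;> fin_cases k <;> fin_cases α <;>
  simp [emb, wedgeCoord, aCoord, aPlusCoord, aMinusCoord, pt, frameVal, rhoVal,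
    Fin.sum_univ_succ, Complex.conj_ofNat] <;> norm_num

theorem gram_mul_rhoSol (k : Fin 2) (α : Fin 4) (i : Fin 5) :
    ∑ j, herm (aCol i) (aCol j) pt * rhoSol k α j = rhoVal k α i := by
  simp only [herm_aCol_aCol]
  fin_cases i <;> fin_cases k <;> fin_cases α <;>
  simp [rhoVal, rhoSol, Fin.sum_univ_succ] <;> norm_num

theorem herm_dz_frame_dz_frame (k : Fin 2) (α : Fin 4) :
    ∑ T, conj (dz α (embF (frameCoord k) T) pt) * dz α (embF (frameCoord k) T) pt =
      !![0, 206 / 105, 50 / 9, 188 / 15; 422 / 35, 32, 4, 2] k α := by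
  simp only [(oneJet_frame _ _).2.2]
  fin_cases k <;> fin_cases α <;>
  simp [emb, wedgeCoord, pt, frameVal, frameDer, Fin.sum_univ_succ, Complex.conj_ofNat] <;> norm_num

/-- The matrix of the metric, without the conformal factor. -/
def frameMat : (Fin 4 → ℂ) → Matrix (Fin 2) (Fin 2) ℂ := schurMat aCol fun k => embF (frameCoord k)

theorem dz_dzbar_frameMat (k : Fin 2) (α : Fin 4) :
    dz α (dzbar α fun w => frameMat w k k) pt =
      !![-11 / 7, -26 / 21, 50 / 9, 37 / 3; 422 / 35, 571 / 21, -61 / 9, -122 / 3] k α := by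
  refine (dz_dzbar_schurMat α α contDiff_aCol (fun k T => (oneJet_frame k T).1)
    det_gramMat_ne_zero herm_aCol_frame (fun i k => herm_aCol_dz_frame i k α) k k
    (c := rhoSol k α) fun i => ?_).trans ?_
  · rw [gram_mul_rhoSol, herm_dz_aCol_frame]
  · simp only [herm_dz_frame_dz_frame, herm_dz_aCol_frame]
    fin_cases k <;> fin_cases α <;>
    simp [rhoVal, rhoSol, Fin.sum_univ_succ, Complex.conj_ofNat] <;> norm_num

theorem frameMat_pt : frameMat pt = !![21, 0; 0, 105] := by
  ext k l
  simp only [frameMat, schurMat, Matrix.of_apply, herm_frame_frame, herm_aCol_frame]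
  simp

theorem dz_frameMat (α : Fin 4) (k l : Fin 2) : dz α (fun w => frameMat w k l) pt = 0 :=
  (dz_schurMat α contDiff_aCol (fun k T => (oneJet_frame k T).1) det_gramMat_ne_zero
    herm_aCol_frame k l).trans (herm_frame_dz_frame k l α)

theorem inv_fubiniStudy_pt : (fubiniStudy pt)⁻¹ = Matrix.diagonal ![25, 5, 5, 5] := by
  refine Matrix.inv_eq_left_inv ?_
  ext α β
  rw [Matrix.diagonal_mul, fubiniStudy, Matrix.of_apply]
  fin_cases α <;> fin_cases β <;>
  simp [pt, Fin.sum_univ_succ, Complex.conj_ofNat] <;> norm_num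

/-- The mean curvature at `pt` is not a multiple of the identity. -/
theorem meanCurvature_frameMat_ne (μ : ℂ) : meanCurvature frameMat pt ≠ μ • 1 := by
  intro h
  have hdet : (frameMat pt).det ≠ 0 := by
    rw [frameMat_pt, Matrix.det_fin_two]; norm_num
  have h1 := meanCurvature_mul_of_dz_eq_zero dz_frameMat hdet
  rw [h, inv_fubiniStudy_pt, frameMat_pt] at h1
  have hk : ∀ k, (μ • 1 * !![21, 0; 0, 105] : Matrix (Fin 2) (Fin 2) ℂ) k k =
      -∑ α : Fin 4, (![25, 5, 5, 5] : Fin 4 → ℂ) α *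
        !![-11 / 7, -26 / 21, 50 / 9, 37 / 3; 422 / 35, 571 / 21, -61 / 9, -122 / 3] k α := by
    intro k
    rw [h1, Matrix.neg_apply, Matrix.sum_apply]
    congr 1
    refine Finset.sum_congr rfl fun α _ => ?_
    rw [Finset.sum_eq_single α (fun β _ hβ => by rw [Matrix.diagonal_apply_ne _ hβ, zero_smul])
      (by simp), Matrix.smul_apply, Matrix.of_apply, Matrix.diagonal_apply_eq, smul_eq_mul,
      dz_dzbar_frameMat]
  -- The two diagonal entries give different values for `μ`.
  have h0 := hk 0
  have h2 := hk 1
  simp [Fin.sum_univ_succ] at h0 h2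
  have : (0 : ℂ) = 1 := by linear_combination -(63 / 1240) * (5 * h0 - h2)
  exact zero_ne_one this

theorem contDiff_nrm : ContDiff ℝ 2 nrm := by
  refine contDiff_const.add (ContDiff.sum fun k _ => ?_)
  have h : ContDiff ℝ 2 fun z : Fin 4 → ℂ => z k := contDiff_apply ℝ ℂ k
  exact h.mul (contDiff_conj h)

theorem differentiable_frameCoord (k : Fin 2) (i : Fin 6) :
    (Differentiable ℂ fun z => (frameCoord k z).1 i) ∧
      Differentiable ℂ fun z => (frameCoord k z).2 i :=
  ⟨(oneJet_frameCoord_fst k i).1.differentiable (by simp),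
    (oneJet_frameCoord_snd k i).1.differentiable (by simp)⟩

theorem eventually_frame : ∀ᶠ z in 𝓝 pt, 1 - z 0 * z 1 * z 2 * z 3 ≠ 0 ∧
    (gramMat aCol z).det ≠ 0 ∧ (frameMat z).det ≠ 0 := by
  have hD : Continuous fun z : Fin 4 → ℂ => 1 - z 0 * z 1 * z 2 * z 3 := by fun_prop
  have hH : ContinuousAt (fun z => (frameMat z).det) pt := by
    have h := fun k l => (contDiffAt_schurMat contDiff_aCol (fun k T => (oneJet_frame k T).1)
      det_gramMat_ne_zero k l).continuousAt
    simp only [Matrix.det_fin_two]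
    exact ((h 0 0).mul (h 1 1)).sub ((h 0 1).mul (h 1 0))
  refine (hD.continuousAt.eventually_ne ?_).and
    ((eventually_det_gramMat_ne_zero contDiff_aCol det_gramMat_ne_zero).and (hH.eventually_ne ?_))
  · simp [pt]
  · rw [frameMat_pt, Matrix.det_fin_two]; norm_num

end HorrocksMumford
end
theorem mainTheorem1 :
    ¬ HorrocksMumford.IsHermitianEinstein HorrocksMumford.E 2
      HorrocksMumford.IsHolomorphicSection := by
  open HorrocksMumford in
  rintro ⟨c, h⟩
  obtain ⟨V, hVP, hV, hpt⟩ := eventually_nhds_iff.1 eventually_frame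
  have hK := h 0 V (fun k => eSection (frameCoord k) (monadEq_frameCoord k)) hV
    (fun k => isHolomorphicSection_eSection _ (fun i => (differentiable_frameCoord k i).1)
      (fun i => (differentiable_frameCoord k i).2) hV)
    (fun z hz => isFrame_eSection monadEq_frameCoord z (hVP z hz).1 (hVP z hz).2.1 (hVP z hz).2.2)
    pt hpt
  have hdet := (hVP pt hpt).2.2
  rw [meanCurvature_congr (H' := fun w => (nrm w)⁻¹ ^ 3 • frameMat w)
    (eventually_frame.mono fun z hz => inner_eSection monadEq_frameCoord z hz.2.1)] at hK
  obtain ⟨κ, hκ⟩ := meanCurvature_smul (f := fun w => (nrm w)⁻¹ ^ 3) (H := frameMat) (z := pt)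
    ((contDiff_nrm.contDiffAt.inv (nrm_ne_zero pt)).pow 3)
    (pow_ne_zero _ (inv_ne_zero (nrm_ne_zero pt)))
    (contDiffAt_schurMat contDiff_aCol (fun k T => (oneJet_frame k T).1) det_gramMat_ne_zero) hdet
  refine meanCurvature_frameMat_ne (c - κ) ?_
  rw [sub_smul, eq_sub_iff_add_eq, ← hκ, hK]
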